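/- For $n\in\mathbb N$ let the nodes be the points of a Poisson process of rate $1$ on the square $[0,\sqrt n]^2$, and let $r(u,v)$ be the Euclidean distance on the torus obtained by identifying opposite edges of the square (i.e. edge effects are ignored). Fix $c>0$. Two distinct nodes $u,v$ with $r(u,v)<\sqrt{c\log n}$ are joined by a local edge (they are local contacts of each other). Given the nodes, every pair $u,v$ with $r(u,v)>\sqrt{c\log n}$ is joined, independently of all other pairs, by a shortcut with probability $\min(a_n\,r(u,v)^{-2},1)$, where $a_n$ is such that (for all sufficiently large $n$) the expected number of shortcuts of a node is $1$. A message from a node $s$ to a node $t$ is routed as follows. It carries the location of $t$ and a radius $r$, initially $r=r(s,t)$. Let $x$ be the node currently holding the message. If $x$ has a direct link to $t$, it delivers the message. Otherwise, if $x$ has a shortcut to a node $y$ in the annulus $A(t,r)=\{y: r/4<r(y,t)\le r/2\}$, it forwards the message to such a node. Otherwise it forwards the message to a local contact that is closer to $t$ than $x$ (if there is none, the message is stuck and is never delivered). A node $y$ receiving the message replaces $r$ by $r/2$ if $r(y,t)\le r/2$ and leaves $r$ unchanged otherwise. If several nodes are admissible as the next one, the choice among them is arbitrary, but depends only on what $x$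 knows: its own location, the location of $t$, the radius $r$, and the locations of its local contacts and of its shortcut contacts. Then there is $c_0>0$ such that for every $c\ge c_0$ there is a constant $C>0$ such that, for every such choice of rules, the probability that for all pairs of nodes $s,t$ the message from $s$ reaches $t$ in at most $C\log^2 n$ hops tends to $1$ as $n\to\infty$. -/

import Mathlib

open Filter Topology MeasureTheory ProbabilityTheory
open scoped ENNReal NNReal

namespace SmallWorld

noncomputable section

open scoped Classical

/-- Locations in the plane. -/
abbrev Pt : Type := ℝ × ℝ

/-- Euclidean distance on the torus obtained by identifying opposite edges of a square of
side `L`. The norm on `AddCircle L` is the distance to the nearest multiple of `L`. -/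
def torusDist (L : ℝ) (x y : Pt) : ℝ :=
  √(‖((x.1 - y.1 : ℝ) : AddCircle L)‖ ^ 2 + ‖((x.2 - y.2 : ℝ) : AddCircle L)‖ ^ 2)

theorem torusDist_comm (L : ℝ) (x y : Pt) : torusDist L x y = torusDist L y x := by
  have h : ∀ a b : ℝ, ‖((a - b : ℝ) : AddCircle L)‖ = ‖((b - a : ℝ) : AddCircle L)‖ := by
    intro a b
    rw [← norm_neg, ← AddCircle.coe_neg, neg_sub]
  unfold torusDist
  rw [h x.1 y.1, h x.2 y.2]

/-! ### The Poisson process -/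

/-- Sample space of the node process: a number of points and a sequence of locations in the
unit square. -/
abbrev NodeSpace : Type := ℕ × (ℕ → unitInterval × unitInterval)

/-- The number of points is Poisson with mean `n`; independently of it, the locations are
independent and uniform on the unit square. -/
def nodeLaw (n : ℕ) : Measure NodeSpace :=
  (poissonMeasure (n : ℝ≥0)).prod (Measure.infinitePi fun _ : ℕ => volume)

/-- The unit-rate Poisson process on `[0, √n]²`: Poisson(`n`) many independent uniform points of
that square. -/
def nodeSet (n : ℕ) (ω : NodeSpace) : Finset Pt :=
  (Finset.range ω.1).image fun i => (√n * ((ω.2 i).1 : ℝ), √n * ((ω.2 i).2 : ℝ))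

/-! ### The random graph -/

/-- The radius `√(c log n)` of the local edges. -/
def localRadius (c : ℝ) (n : ℕ) : ℝ := √(c * Real.log n)

/-- Probability of a shortcut between nodes at `u` and `v`: it is `a r⁻² ∧ 1` if the distance `r`
exceeds the local radius; nodes that are closer are not joined by shortcuts. -/
def shortcutProb (c : ℝ) (n : ℕ) (a : ℝ) (u v : Pt) : ℝ :=
  if localRadius c n < torusDist √n u v then min (a / torusDist √n u v ^ 2) 1 else 0

/-- `shortcutProb` as a function of the unordered pair. -/
def pairProb (c : ℝ) (n : ℕ) (a : ℝ) : Sym2 Pt → ℝ :=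
  Sym2.lift ⟨shortcutProb c n a, fun u v => by simp only [shortcutProb, torusDist_comm _ u v]⟩

/-- Expected number of shortcuts from a node located at `x` to the points of the Poisson
process. -/
def expectedShortcuts (c : ℝ) (n : ℕ) (a : ℝ) (x : Pt) : ℝ≥0∞ :=
  ∫⁻ ω, ∑ v ∈ nodeSet n ω, ENNReal.ofReal (shortcutProb c n a x v) ∂(nodeLaw n)

/-- The unordered pairs of distinct nodes. -/
def nodePairs (V : Finset Pt) : Finset (Sym2 Pt) := V.sym2.filter fun e => ¬ e.IsDiag

/-- Given the node set `V`, the probability that `S` is the set of all shortcuts: distinct pairs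
of nodes are joined independently, the pair `e` with probability `pairProb c n a e`. -/
def shortcutWeight (c : ℝ) (n : ℕ) (a : ℝ) (V : Finset Pt) (S : Finset (Sym2 Pt)) : ℝ :=
  (∏ e ∈ S, pairProb c n a e) * ∏ e ∈ nodePairs V \ S, (1 - pairProb c n a e)

/-- Probability of an event `E` (a property of the node set and of the shortcut set) in the
small-world graph: average over the Poisson process of the conditional probability given the
node set. -/
def graphProb (c : ℝ) (n : ℕ) (a : ℝ) (E : Finset Pt → Finset (Sym2 Pt) → Prop) : ℝ≥0∞ :=
  ∫⁻ ω, ENNReal.ofReal (∑ S ∈ (nodePairs (nodeSet n ω)).powerset.filter (E (nodeSet n ω)),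
    shortcutWeight c n a (nodeSet n ω) S) ∂(nodeLaw n)

/-- Local contacts of `x`: the other nodes at distance less than `√(c log n)`. -/
def localContacts (c : ℝ) (n : ℕ) (V : Finset Pt) (x : Pt) : Finset Pt :=
  V.filter fun y => y ≠ x ∧ torusDist √n x y < localRadius c n

/-- The nodes joined to `x` by a shortcut. -/
def shortcutContacts (V : Finset Pt) (S : Finset (Sym2 Pt)) (x : Pt) : Finset Pt :=
  V.filter fun y => s(x, y) ∈ S

/-! ### The routing algorithm -/

/-- What a node holding the message knows: its own location, the location of the target and the
radius (both carried by the message), and the locations of its local and shortcut contacts. -/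
structure View where
  position : Pt
  target : Pt
  radius : ℝ
  locals : Finset Pt
  shortcuts : Finset Pt

/-- The shortcut contacts in the annulus `A(t, r) = C(t, r/2) \ C(t, r/4)`. -/
def View.annulusShortcuts (n : ℕ) (w : View) : Finset Pt :=
  w.shortcuts.filter fun y =>
    torusDist √n y w.target ≤ w.radius / 2 ∧ ¬ torusDist √n y w.target ≤ w.radius / 4

/-- The local contacts that are closer to the target than the node itself. -/
def View.closerLocals (n : ℕ) (w : View) : Finset Pt :=
  w.locals.filter fun y => torusDist √n y w.target < torusDist √n w.position w.target

/-- `next` is a version of the approximately greedy decentralised algorithm. It chooses the next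
holder of the message from the view of the current one: the target if it is a contact; otherwise
a shortcut contact in the annulus, if there is one; otherwise a local contact closer to the
target, if there is one; otherwise the message is stuck. All choices among several admissible
contacts are arbitrary. -/
def IsApproxGreedy (n : ℕ) (next : View → Pt) : Prop :=
  ∀ w : View,
    if w.target ∈ w.locals ∪ w.shortcuts then next w = w.target
    else if (w.annulusShortcuts n).Nonempty then next w ∈ w.annulusShortcuts n
    else if (w.closerLocals n).Nonempty then next w ∈ w.closerLocals n
    else next w = w.position

/-- One hop: the state is the location of the message together with the radius it carries. The
receiving node `y` halves the radius `r` if its distance from the target is at most `r / 2`. -/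
def hop (c : ℝ) (n : ℕ) (next : View → Pt) (V : Finset Pt) (S : Finset (Sym2 Pt)) (t : Pt)
    (p : Pt × ℝ) : Pt × ℝ :=
  let y := next ⟨p.1, t, p.2, localContacts c n V p.1, shortcutContacts V S p.1⟩
  (y, if torusDist √n y t ≤ p.2 / 2 then p.2 / 2 else p.2)

/-- The message sent from `s` to `t`, with initial radius `r(s, t)`, reaches `t` in at most `K`
hops. -/
def DeliveredWithin (c : ℝ) (n : ℕ) (next : View → Pt) (V : Finset Pt) (S : Finset (Sym2 Pt))
    (s t : Pt) (K : ℝ) : Prop :=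
  ∃ k : ℕ, (k : ℝ) ≤ K ∧ ((hop c n next V S t)^[k] (s, torusDist √n s t)).1 = t

end

end SmallWorld

/-!
The shortcuts are revealed along the route, each time only those of the current holder of the
message. The message always moves to a node strictly closer to the target, so the pairs formed by
the new holder and the nodes still closer have not been looked at, and each hop meets fresh
randomness.

If the nodes are spread evenly, then at a radius `r > 8 √(c log n)` the holder has a shortcut to the
annulus `A(t, r)`, and thus halves `r`, with probability at least `1 - exp (-q)`, where `q` is of
order `1 / log n`: the annulus contains about `r²` nodes, each reached with probability about
`a / r²`, and `a` is at least of order `1 / log n` by the normalization. Hence the expectation of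
`r / √(c log n)` over the event that the message is still on its way contracts by the factor
`(1 + exp (-q)) / 2` in each hop, and after `O(log² n)` hops it is below `n⁻³`. A message whose
radius is at most `8 √(c log n)` needs only `O(log n)` further hops, since it visits distinct nodes
of a disc containing `O(log n)` nodes. A union bound over the `O(n²)` pairs of nodes, together with
Chernoff bounds for the number of Poisson points in the cells of grids and in discs, concludes.
-/

namespace SmallWorld

/-! ### The torus -/

section Torus

variable {L : ℝ}

/-- The image of a location in the flat torus of side `L`, that is in the product of two circles
with its `ℓ²` metric: `torusDist L` is the distance of a seminormed group. -/
def toTorus (L : ℝ) (x : Pt) : WithLp 2 (AddCircle L × AddCircle L) :=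
  WithLp.toLp 2 ((x.1 : AddCircle L), (x.2 : AddCircle L))

theorem torusDist_eq_dist (L : ℝ) (x y : Pt) :
    torusDist L x y = dist (toTorus L x) (toTorus L y) := by
  rw [dist_eq_norm, WithLp.prod_norm_eq_of_L2]
  rfl

theorem torusDist_nonneg (L : ℝ) (x y : Pt) : 0 ≤ torusDist L x y := Real.sqrt_nonneg _

theorem torusDist_self (L : ℝ) (x : Pt) : torusDist L x x = 0 := by
  rw [torusDist_eq_dist, dist_self]

theorem torusDist_triangle (L : ℝ) (x y z : Pt) :
    torusDist L x z ≤ torusDist L x y + torusDist L y z := by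
  simpa only [torusDist_eq_dist] using dist_triangle _ _ _

theorem continuous_toTorus (L : ℝ) : Continuous (toTorus L) := by
  unfold toTorus
  fun_prop

theorem torusDist_le_mul {s : ℝ} {x y z w : Pt} (hs : 0 ≤ s)
    (h₁ : ‖((x.1 - y.1 : ℝ) : AddCircle L)‖ ≤ s * ‖((z.1 - w.1 : ℝ) : AddCircle L)‖)
    (h₂ : ‖((x.2 - y.2 : ℝ) : AddCircle L)‖ ≤ s * ‖((z.2 - w.2 : ℝ) : AddCircle L)‖) :
    torusDist L x y ≤ s * torusDist L z w := by
  rw [torusDist, torusDist, ← Real.sqrt_mul_self hs, ← Real.sqrt_mul (mul_self_nonneg s), ← sq,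
    mul_add, ← mul_pow, ← mul_pow]
  gcongr

theorem norm_coe_le_abs (L x : ℝ) : ‖(x : AddCircle L)‖ ≤ |x| :=
  QuotientAddGroup.norm_mk_le_norm

theorem torusDist_le_of_norm_le {s : ℝ} {x y : Pt} (h₁ : ‖((x.1 - y.1 : ℝ) : AddCircle L)‖ ≤ s)
    (h₂ : ‖((x.2 - y.2 : ℝ) : AddCircle L)‖ ≤ s) : torusDist L x y ≤ 2 * s := by
  have hs : 0 ≤ s := (norm_nonneg _).trans h₁
  have b₁ := pow_le_pow_left₀ (norm_nonneg _) h₁ 2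
  have b₂ := pow_le_pow_left₀ (norm_nonneg _) h₂ 2
  exact Real.sqrt_le_iff.2 ⟨by positivity, by nlinarith only [b₁, b₂, sq_nonneg s]⟩

theorem norm_fst_sub_le_torusDist (L : ℝ) (x y : Pt) :
    ‖((x.1 - y.1 : ℝ) : AddCircle L)‖ ≤ torusDist L x y :=
  Real.le_sqrt_of_sq_le (le_add_of_nonneg_right (sq_nonneg _))

theorem norm_snd_sub_le_torusDist (L : ℝ) (x y : Pt) :
    ‖((x.2 - y.2 : ℝ) : AddCircle L)‖ ≤ torusDist L x y :=
  Real.le_sqrt_of_sq_le (le_add_of_nonneg_left (sq_nonneg _))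

theorem torusDist_sq_le (hL : L ≠ 0) (x y : Pt) : torusDist L x y ^ 2 ≤ L ^ 2 / 2 := by
  rw [torusDist, Real.sq_sqrt (by positivity)]
  have b₁ := pow_le_pow_left₀ (norm_nonneg _)
    (AddCircle.norm_le_half_period L (x := ((x.1 - y.1 : ℝ) : AddCircle L)) hL) 2
  have b₂ := pow_le_pow_left₀ (norm_nonneg _)
    (AddCircle.norm_le_half_period L (x := ((x.2 - y.2 : ℝ) : AddCircle L)) hL) 2
  rw [div_pow, sq_abs] at b₁ b₂
  linarith

theorem torusDist_le_period (hL : 0 < L) (x y : Pt) : torusDist L x y ≤ L :=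
  abs_le_of_sq_le_sq' ((torusDist_sq_le hL.ne' x y).trans (by nlinarith)) hL.le |>.2

theorem torusDist_horizontal {h : ℝ} (hL : 0 < L) (h0 : 0 ≤ h) (h1 : h ≤ L / 2) (t : Pt) :
    torusDist L (t.1 + h, t.2) t = h := by
  have : ‖((h : ℝ) : AddCircle L)‖ = h := by
    rw [(AddCircle.norm_coe_eq_abs_iff L hL.ne').2, abs_of_nonneg h0]
    rwa [abs_of_nonneg h0, abs_of_pos hL]
  simp only [torusDist, add_sub_cancel_left, sub_self, this, AddCircle.coe_zero, norm_zero]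
  rw [zero_pow two_ne_zero, add_zero, Real.sqrt_sq h0]

theorem exists_coe_eq_and_abs_eq_norm (u : AddCircle L) :
    ∃ e : ℝ, (e : AddCircle L) = u ∧ |e| = ‖u‖ := by
  obtain ⟨x, rfl⟩ := QuotientAddGroup.mk_surjective u
  refine ⟨x - round (L⁻¹ * x) * L, ?_, (AddCircle.norm_eq L).symm⟩
  rw [AddCircle.coe_sub, ← zsmul_eq_mul, AddCircle.coe_zsmul, AddCircle.coe_period, smul_zero,
    sub_zero]

theorem exists_torusDist_toward {h : ℝ} {x t : Pt} (h0 : 0 ≤ h) (h1 : h ≤ torusDist L x t) :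
    ∃ z : Pt, torusDist L x z ≤ h ∧ torusDist L z t ≤ torusDist L x t - h := by
  obtain ⟨e₁, he₁, hn₁⟩ := exists_coe_eq_and_abs_eq_norm ((x.1 - t.1 : ℝ) : AddCircle L)
  obtain ⟨e₂, he₂, hn₂⟩ := exists_coe_eq_and_abs_eq_norm ((x.2 - t.2 : ℝ) : AddCircle L)
  set s := h / torusDist L x t
  have hs0 : 0 ≤ s := div_nonneg h0 (h0.trans h1)
  have hs1 : 0 ≤ 1 - s := sub_nonneg.2 (div_le_one_of_le₀ h1 (h0.trans h1))
  have hsd : s * torusDist L x t = h := div_mul_cancel_of_imp fun hd => by linarith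
  have near (e : ℝ) : ‖((s * e : ℝ) : AddCircle L)‖ ≤ s * |e| :=
    (norm_coe_le_abs L _).trans_eq (by rw [abs_mul, abs_of_nonneg hs0])
  have far {a b e : ℝ} (he : (e : AddCircle L) = ((a - b : ℝ) : AddCircle L)) :
      ‖((a - s * e - b : ℝ) : AddCircle L)‖ ≤ (1 - s) * |e| := by
    have : ((a - s * e - b : ℝ) : AddCircle L) = (((1 - s) * e : ℝ) : AddCircle L) := by
      rw [sub_right_comm, AddCircle.coe_sub, ← he, ← AddCircle.coe_sub, sub_mul, one_mul]
    rw [this]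
    exact (norm_coe_le_abs L _).trans_eq (by rw [abs_mul, abs_of_nonneg hs1])
  refine ⟨(x.1 - s * e₁, x.2 - s * e₂), ?_, ?_⟩
  · rw [← hsd]
    refine torusDist_le_mul hs0 ?_ ?_
    · rw [← hn₁, sub_sub_cancel]; exact near e₁
    · rw [← hn₂, sub_sub_cancel]; exact near e₂
  · rw [← hsd, ← one_sub_mul]
    refine torusDist_le_mul hs1 ?_ ?_
    · rw [← hn₁]; exact far he₁
    · rw [← hn₂]; exact far he₂

end Torus

/-! ### Resampling independent pairs -/

section Resample

variable {α : Type*} [DecidableEq α]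

/-- The expectation of `g` when the coins in `F` are tossed afresh, independently and with success
probabilities `p`, while the outcome of the other coins, given by the set `S` of successes, is
kept. -/
def resample (p : α → ℝ) (F : Finset α) (g : Finset α → ℝ) (S : Finset α) : ℝ :=
  ∑ T ∈ F.powerset, ((∏ e ∈ T, p e) * ∏ e ∈ F \ T, (1 - p e)) * g ((S \ F) ∪ T)

variable {p : α → ℝ} {F G : Finset α} {g h : Finset α → ℝ}

theorem resample_empty (p : α → ℝ) (g : Finset α → ℝ) (S : Finset α) :
    resample p ∅ g S = g S := by
  simp [resample]

theorem resample_insert {e : α} (he : e ∉ F) (g : Finset α → ℝ) (S : Finset α) :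
    resample p (insert e F) g S =
      p e * resample p F g (insert e S) + (1 - p e) * resample p F g (S.erase e) := by
  unfold resample
  rw [Finset.sum_powerset_insert he, add_comm, Finset.mul_sum, Finset.mul_sum]
  congr 1 <;> refine Finset.sum_congr rfl fun T hT => ?_ <;>
    have heT : e ∉ T := fun h => he (Finset.mem_powerset.1 hT h)
  · have coins : insert e F \ insert e T = F \ T := by grind
    have outcome : S \ insert e F ∪ insert e T = insert e S \ F ∪ T := by grind
    rw [coins, outcome, Finset.prod_insert heT]
    ring
  · have coins : insert e F \ T = insert e (F \ T) := by grind
    have outcome : S \ insert e F ∪ T = S.erase e \ F ∪ T := by grind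
    rw [coins, outcome, Finset.prod_insert (by simp [he])]
    ring

theorem resample_union (hFG : Disjoint F G) (g : Finset α → ℝ) (S : Finset α) :
    resample p (F ∪ G) g S = resample p F (resample p G g) S := by
  induction F using Finset.induction_on generalizing S with
  | empty => simp [resample_empty]
  | insert e F he ih =>
    rw [Finset.disjoint_insert_left] at hFG
    rw [Finset.insert_union, resample_insert (by simp [he, hFG.1]), resample_insert he,
      ih hFG.2, ih hFG.2]

theorem resample_const (b : ℝ) (S : Finset α) : resample p F (fun _ => b) S = b := by
  induction F using Finset.induction_on generalizing S with
  | empty => simp [resample_empty]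
  | insert e F he ih => rw [resample_insert he, ih, ih]; ring

theorem resample_mono (hp : ∀ e ∈ F, p e ∈ Set.Icc (0 : ℝ) 1) {S : Finset α}
    (hgh : ∀ S', (∀ e ∉ F, e ∈ S' ↔ e ∈ S) → g S' ≤ h S') :
    resample p F g S ≤ resample p F h S := by
  refine Finset.sum_le_sum fun T hT => ?_
  have hTF := Finset.mem_powerset.1 hT
  have weight_nonneg : 0 ≤ (∏ e ∈ T, p e) * ∏ e ∈ F \ T, (1 - p e) :=
    mul_nonneg (Finset.prod_nonneg fun e he => (hp e (hTF he)).1)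
      (Finset.prod_nonneg fun e he => sub_nonneg.2 (hp e (Finset.sdiff_subset he)).2)
  exact mul_le_mul_of_nonneg_left (hgh _ fun e he => by grind) weight_nonneg

theorem resample_le_of_forall_le (hp : ∀ e ∈ F, p e ∈ Set.Icc (0 : ℝ) 1) {S : Finset α} {b : ℝ}
    (hg : ∀ S', (∀ e ∉ F, e ∈ S' ↔ e ∈ S) → g S' ≤ b) : resample p F g S ≤ b :=
  (resample_mono hp hg).trans_eq (resample_const b S)

theorem resample_le_of_subset (hp : ∀ e ∈ G, p e ∈ Set.Icc (0 : ℝ) 1) (hFG : F ⊆ G) {b : ℝ}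
    (hg : ∀ S, resample p F g S ≤ b) (S : Finset α) : resample p G g S ≤ b := by
  rw [← Finset.sdiff_union_of_subset hFG, resample_union Finset.sdiff_disjoint]
  exact resample_le_of_forall_le (fun e he => hp e (Finset.sdiff_subset he)) fun S' _ => hg S'

theorem resample_add_mul (b d : ℝ) (S : Finset α) :
    resample p F (fun S => b + d * g S) S = b + d * resample p F g S := by
  conv_rhs => rw [← resample_const (p := p) (F := F) b S]
  simp only [resample, Finset.mul_sum, ← Finset.sum_add_distrib]
  exact Finset.sum_congr rfl fun T _ => by ring

theorem resample_sum {ι : Type*} (I : Finset ι) (f : ι → Finset α → ℝ) (S : Finset α) :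
    resample p F (fun S => ∑ i ∈ I, f i S) S = ∑ i ∈ I, resample p F (f i) S := by
  simp only [resample, Finset.mul_sum]
  exact Finset.sum_comm

theorem resample_disjoint_self (A S : Finset α) :
    resample p A (fun S => if Disjoint A S then 1 else 0) S = ∏ e ∈ A, (1 - p e) := by
  rw [resample, Finset.sum_eq_single ∅]
  · simp [Finset.disjoint_sdiff]
  · intro T hT hne
    have meets : ¬ Disjoint A (S \ A ∪ T) := by
      obtain ⟨e, he⟩ := Finset.nonempty_iff_ne_empty.2 hne
      exact Finset.not_disjoint_iff.2
        ⟨e, Finset.mem_powerset.1 hT he, Finset.mem_union_right _ he⟩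
    rw [if_neg meets, mul_zero]
  · simp

theorem resample_disjoint {A : Finset α} (hA : A ⊆ F) (S : Finset α) :
    resample p F (fun S => if Disjoint A S then 1 else 0) S = ∏ e ∈ A, (1 - p e) := by
  rw [← Finset.sdiff_union_of_subset hA, resample_union Finset.sdiff_disjoint]
  simp only [funext (resample_disjoint_self A), resample_const]

theorem resample_disjoint_le {A : Finset α} (hA : A ⊆ F) (hp : ∀ e ∈ A, p e ≤ 1)
    (S : Finset α) :
    resample p F (fun S => if Disjoint A S then 1 else 0) S ≤ Real.exp (-∑ e ∈ A, p e) := by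
  rw [resample_disjoint hA, ← Finset.sum_neg_distrib, Real.exp_sum]
  exact Finset.prod_le_prod (fun e he => sub_nonneg.2 (hp e he))
    fun e _ => Real.one_sub_le_exp_neg (p e)

end Resample

/-! ### Paths of the message -/

section Routing

variable {c : ℝ} {n : ℕ} {next : View → Pt} {V : Finset Pt} {S : Finset (Sym2 Pt)} {t : Pt}

/-- Greedy routing along local edges towards `t` never gets stuck: every node that is not joined to
`t` by a local edge has a local contact closer to `t`. -/
def HasCloserContacts (c : ℝ) (n : ℕ) (V : Finset Pt) (t : Pt) : Prop :=
  ∀ x ∈ V, localRadius c n ≤ torusDist √n x t →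
    ∃ y ∈ V, torusDist √n x y < localRadius c n ∧ torusDist √n y t < torusDist √n x t

/-- The nodes in the annulus `A(t, r)`. -/
noncomputable def annulusNodes (n : ℕ) (V : Finset Pt) (t : Pt) (r : ℝ) : Finset Pt :=
  V.filter fun y => r / 4 < torusDist √n y t ∧ torusDist √n y t ≤ r / 2

/-- The nodes that are strictly closer to `t` than `x`. -/
noncomputable def closerNodes (n : ℕ) (V : Finset Pt) (t x : Pt) : Finset Pt :=
  V.filter fun y => torusDist √n y t < torusDist √n x t

theorem mem_annulusNodes {r : ℝ} {y : Pt} :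
    y ∈ annulusNodes n V t r ↔
      y ∈ V ∧ r / 4 < torusDist √n y t ∧ torusDist √n y t ≤ r / 2 := Finset.mem_filter

theorem mem_closerNodes {x y : Pt} :
    y ∈ closerNodes n V t x ↔ y ∈ V ∧ torusDist √n y t < torusDist √n x t := Finset.mem_filter

theorem closerNodes_ssubset {x y : Pt} (hy : y ∈ closerNodes n V t x) :
    closerNodes n V t y ⊂ closerNodes n V t x := by
  have hyx := (mem_closerNodes.1 hy).2
  refine (Finset.ssubset_iff_of_subset fun z hz => ?_).2 ⟨y, hy, ?_⟩
  · exact mem_closerNodes.2 ((mem_closerNodes.1 hz).imp_right hyx.trans')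
  · exact fun h => lt_irrefl _ (mem_closerNodes.1 h).2

theorem card_closerNodes_le {ρ : ℝ} {N : ℕ}
    (hN : (V.filter fun y => torusDist √n y t ≤ ρ).card ≤ N) {x : Pt}
    (hx : torusDist √n x t ≤ ρ) : (closerNodes n V t x).card ≤ N :=
  (Finset.card_le_card (Finset.monotone_filter_right V fun _ _ hy => (hy.trans_le hx).le)).trans hN

/-- The message in state `p`, a pair of its holder and the radius it carries, reaches `t` in at
most `k` hops. -/
def ReachesWithin (c : ℝ) (n : ℕ) (next : View → Pt) (V : Finset Pt) (S : Finset (Sym2 Pt))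
    (t : Pt) (k : ℕ) (p : Pt × ℝ) : Prop :=
  ∃ j ≤ k, ((hop c n next V S t)^[j] p).1 = t

theorem ReachesWithin.of_fst_eq {p : Pt × ℝ} (h : p.1 = t) (k : ℕ) :
    ReachesWithin c n next V S t k p := ⟨0, k.zero_le, h⟩

theorem ReachesWithin.of_hop {k : ℕ} {p : Pt × ℝ}
    (h : ReachesWithin c n next V S t k (hop c n next V S t p)) :
    ReachesWithin c n next V S t (k + 1) p := by
  obtain ⟨j, hj, h⟩ := h
  exact ⟨j + 1, by omega, by rwa [Function.iterate_succ_apply]⟩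

theorem ReachesWithin.mono {k l : ℕ} {p : Pt × ℝ} (hkl : k ≤ l)
    (h : ReachesWithin c n next V S t k p) : ReachesWithin c n next V S t l p := by
  obtain ⟨j, hj, h⟩ := h
  exact ⟨j, hj.trans hkl, h⟩

theorem hop_congr {S S' : Finset (Sym2 Pt)} {p : Pt × ℝ}
    (h : ∀ y, s(p.1, y) ∈ S ↔ s(p.1, y) ∈ S') :
    hop c n next V S t p = hop c n next V S' t p := by
  have : shortcutContacts V S p.1 = shortcutContacts V S' p.1 := Finset.filter_congr fun y _ => h y
  simp only [hop, this]

/-- The three possible results `q` of a hop of a message held by `x` with radius `r`: delivery; a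
shortcut into the annulus; or, only if no such shortcut exists, a local edge towards `t`. -/
inductive HopOutcome (c : ℝ) (n : ℕ) (V : Finset Pt) (S : Finset (Sym2 Pt)) (t x : Pt) (r : ℝ)
    (q : Pt × ℝ) : Prop
  | delivered (eq : q.1 = t)
  | shortcut (far : localRadius c n ≤ torusDist √n x t) (mem : q.1 ∈ annulusNodes n V t r)
      (radius : q.2 = r / 2)
  | localEdge (far : localRadius c n ≤ torusDist √n x t)
      (no_shortcut : ∀ y ∈ annulusNodes n V t r, s(x, y) ∉ S)
      (mem : q.1 ∈ closerNodes n V t x) (near : torusDist √n x q.1 < localRadius c n)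
      (radius : q.2 = if torusDist √n q.1 t ≤ r / 2 then r / 2 else r)

theorem hopOutcome_hop (hnext : IsApproxGreedy n next) (hV : HasCloserContacts c n V t)
    (ht : t ∈ V) {p : Pt × ℝ} (hp : p.1 ∈ V) (hpt : p.1 ≠ t) :
    HopOutcome c n V S t p.1 p.2 (hop c n next V S t p) := by
  obtain ⟨x, r⟩ := p
  set w : View := ⟨x, t, r, localContacts c n V x, shortcutContacts V S x⟩ with hw
  have hhop : hop c n next V S t (x, r) =
      (next w, if torusDist √n (next w) t ≤ r / 2 then r / 2 else r) := rfl
  have mem_annulus : ∀ y, y ∈ w.annulusShortcuts n ↔ y ∈ annulusNodes n V t r ∧ s(x, y) ∈ S := by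
    intro y
    simp only [hw, View.annulusShortcuts, shortcutContacts, Finset.mem_filter, not_le,
      mem_annulusNodes]
    tauto
  have mem_closer : ∀ y, y ∈ w.closerLocals n ↔
      y ∈ closerNodes n V t x ∧ torusDist √n x y < localRadius c n := by
    intro y
    have ne_of_closer : torusDist √n y t < torusDist √n x t → y ≠ x := by
      rintro h rfl; exact lt_irrefl _ h
    simp only [hw, View.closerLocals, localContacts, Finset.mem_filter, mem_closerNodes]
    tauto
  have hg := hnext w
  rw [hhop]
  split_ifs at hg with h_direct h_annulus h_closer
  · exact .delivered hg
  all_goals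
    have far : localRadius c n ≤ torusDist √n x t := by
      by_contra! hlt
      exact h_direct (Finset.mem_union_left _
        (Finset.mem_filter.2 ⟨ht, hpt.symm, hlt⟩))
  · have := (mem_annulus _).1 hg
    exact .shortcut far this.1 (if_pos (mem_annulusNodes.1 this.1).2.2)
  · have := (mem_closer _).1 hg
    exact .localEdge far (fun y hy hs => h_annulus ⟨y, (mem_annulus y).2 ⟨hy, hs⟩⟩)
      this.1 this.2 rfl
  · obtain ⟨y, hy, hxy, hyt⟩ := hV x hp far
    exact absurd ⟨y, (mem_closer y).2 ⟨mem_closerNodes.2 ⟨hy, hyt⟩, hxy⟩⟩ h_closer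

/-- Each hop at a fixed radius has a new holder among the at most `N` nodes within distance `ρ` of
`t`, so that radius is halved, or the message delivered, after at most `N + 1` hops. -/
theorem reachesWithin_near (hnext : IsApproxGreedy n next) (hV : HasCloserContacts c n V t)
    (ht : t ∈ V) (hR : 0 < localRadius c n) {ρ : ℝ} {N : ℕ}
    (hN : (V.filter fun y => torusDist √n y t ≤ ρ).card ≤ N) (k : ℕ) :
    ∀ (j : ℕ) (p : Pt × ℝ), p.1 ∈ V → torusDist √n p.1 t ≤ p.2 → p.2 ≤ ρ →
      p.2 ≤ 2 ^ j * (localRadius c n / 2) →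
      j * (N + 1) + (closerNodes n V t p.1).card + 1 ≤ k →
      ReachesWithin c n next V S t k p := by
  induction k with
  | zero => intro j p _ _ _ _ h; omega
  | succ k ih =>
    intro j p hp hpr hrρ hrj hk
    by_cases hpt : p.1 = t
    · exact .of_fst_eq hpt _
    have halved (far : localRadius c n ≤ torusDist √n p.1 t) {q : Pt × ℝ} (hq : q.1 ∈ V)
        (hqr : torusDist √n q.1 t ≤ p.2 / 2) (hq2 : q.2 = p.2 / 2) :
        ReachesWithin c n next V S t k q := by
      obtain _ | j := j
      · simp only [pow_zero, one_mul] at hrj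
        linarith
      have hr0 : 0 ≤ p.2 := (torusDist_nonneg _ _ _).trans hpr
      rw [pow_succ] at hrj
      refine ih j q hq (hqr.trans_eq hq2.symm) (by linarith) (by linarith) ?_
      have hcard := card_closerNodes_le (n := n) hN (x := q.1) (t := t) (by linarith)
      grind
    rcases hopOutcome_hop (S := S) hnext hV ht hp hpt with
      h | ⟨far, hq, hq2⟩ | ⟨far, -, hq, -, hq2⟩
    · exact .mono (Nat.le_add_left 1 k) (.of_hop (.of_fst_eq h 0))
    · rw [mem_annulusNodes] at hq
      exact .of_hop (halved far hq.1 hq.2.2 hq2)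
    · have hlt := Finset.card_lt_card (closerNodes_ssubset hq)
      rw [mem_closerNodes] at hq
      split_ifs at hq2 with hqr
      · exact .of_hop (halved far hq.1 hqr hq2)
      · exact .of_hop (ih j _ hq.1 (by linarith) (by linarith) (by linarith) (by omega))

theorem reachesWithin_of_radius_le (hnext : IsApproxGreedy n next)
    (hV : HasCloserContacts c n V t) (ht : t ∈ V) (hR : 0 < localRadius c n) {N : ℕ}
    (hN : (V.filter fun y => torusDist √n y t ≤ 8 * localRadius c n).card ≤ N) {p : Pt × ℝ}
    (hp : p.1 ∈ V) (hpr : torusDist √n p.1 t ≤ p.2) (hr : p.2 ≤ 8 * localRadius c n) :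
    ReachesWithin c n next V S t (5 * N + 5) p := by
  have hcard := card_closerNodes_le (n := n) hN (hpr.trans hr)
  exact reachesWithin_near hnext hV ht hR hN _ 4 p hp hpr hr (by linarith) (by omega)

/-- An invariant of the state `p` of a message on its way to `t`: while the radius is large, it
exceeds the distance to `t` by a factor less than `2`. -/
structure IsRoutingState (c : ℝ) (n : ℕ) (V : Finset Pt) (t : Pt) (p : Pt × ℝ) : Prop where
  mem : p.1 ∈ V
  dist_le : torusDist √n p.1 t ≤ p.2
  half_lt : 8 * localRadius c n < p.2 → p.2 / 2 < torusDist √n p.1 t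

theorem IsRoutingState.hop_cases (hnext : IsApproxGreedy n next) (hV : HasCloserContacts c n V t)
    (ht : t ∈ V) {p : Pt × ℝ} (hp : IsRoutingState c n V t p) (hr : 8 * localRadius c n < p.2) :
    (hop c n next V S t p).1 = t ∨
      IsRoutingState c n V t (hop c n next V S t p) ∧
      (hop c n next V S t p).1 ∈ closerNodes n V t p.1 ∧
      ((hop c n next V S t p).2 = p.2 / 2 ∨ (hop c n next V S t p).2 ≤ p.2 ∧
        ∀ y ∈ annulusNodes n V t p.2, s(p.1, y) ∉ S) := by
  have hR : 0 ≤ localRadius c n := Real.sqrt_nonneg _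
  have hlt := hp.half_lt hr
  have hpt : p.1 ≠ t := fun h => by rw [h, torusDist_self] at hlt; linarith
  rcases hopOutcome_hop (S := S) hnext hV ht hp.mem hpt with
    h | ⟨-, hq, hq2⟩ | ⟨-, hno, hq, hnear, hq2⟩
  · exact .inl h
  · obtain ⟨hqV, hqlt, hqle⟩ := mem_annulusNodes.1 hq
    exact .inr ⟨⟨hqV, by linarith, fun _ => by linarith⟩,
      mem_closerNodes.2 ⟨hqV, by linarith⟩, .inl hq2⟩
  · have htri := torusDist_triangle √n p.1 (hop c n next V S t p).1 t
    have hqV := (mem_closerNodes.1 hq).1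
    have hcloser := (mem_closerNodes.1 hq).2.trans_le hp.dist_le
    refine .inr ⟨?_, hq, .inr ⟨?_, hno⟩⟩
    · split_ifs at hq2 with hqr
      · exact ⟨hqV, by linarith, fun _ => by linarith⟩
      · exact ⟨hqV, by linarith, fun _ => by linarith⟩
    · split_ifs at hq2 <;> linarith

end Routing

/-! ### Delivery with high probability -/

section Delivery

variable {c : ℝ} {n : ℕ} {a : ℝ} {next : View → Pt} {V : Finset Pt} {S : Finset (Sym2 Pt)}
  {t : Pt}

theorem mk_mem_nodePairs {x y : Pt} : s(x, y) ∈ nodePairs V ↔ (x ∈ V ∧ y ∈ V) ∧ x ≠ y := by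
  simp [nodePairs]

theorem nodePairs_mono {U V : Finset Pt} (h : U ⊆ V) : nodePairs U ⊆ nodePairs V :=
  Finset.filter_subset_filter _ (Finset.sym2_mono h)

theorem nodePairs_insert {U : Finset Pt} {x : Pt} (hx : x ∉ U) :
    nodePairs (insert x U) = U.image (fun y => s(x, y)) ∪ nodePairs U := by
  ext e
  induction e with | _ y z
  simp only [mk_mem_nodePairs, Finset.mem_union, Finset.mem_image, Finset.mem_insert,
    Sym2.eq_iff]
  grind

theorem disjoint_star_nodePairs {U : Finset Pt} {x : Pt} (hx : x ∉ U) :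
    Disjoint (U.image (fun y => s(x, y))) (nodePairs U) := by
  rw [Finset.disjoint_left]
  intro e he
  obtain ⟨y, -, rfl⟩ := Finset.mem_image.1 he
  simp [mk_mem_nodePairs, hx]

theorem pairProb_mem_Icc (ha : 0 ≤ a) (e : Sym2 Pt) : pairProb c n a e ∈ Set.Icc (0 : ℝ) 1 := by
  induction e with | _ x y
  change shortcutProb c n a x y ∈ _
  unfold shortcutProb
  split_ifs
  · exact ⟨le_min (by positivity) zero_le_one, min_le_right _ _⟩
  · exact ⟨le_rfl, zero_le_one⟩

/-- A node `x` whose distance from `t` exceeds half of a large radius `r`, but not `r`, has at least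
`q` expected shortcuts into the annulus `A(t, r)`. -/
def HasAnnulusShortcuts (c : ℝ) (n : ℕ) (a : ℝ) (V : Finset Pt) (t : Pt) (q : ℝ) : Prop :=
  ∀ x ∈ V, ∀ r, 8 * localRadius c n < r → r / 2 < torusDist √n x t → torusDist √n x t ≤ r →
    q ≤ ∑ y ∈ annulusNodes n V t r, shortcutProb c n a x y

open Classical in
/-- The indicator of the event that the message in state `p` needs more than `k` hops to `t`, as a
function of the set of shortcuts. -/
noncomputable def late (c : ℝ) (n : ℕ) (next : View → Pt) (V : Finset Pt) (t : Pt) (k : ℕ)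
    (p : Pt × ℝ) (S : Finset (Sym2 Pt)) : ℝ :=
  if ReachesWithin c n next V S t k p then 0 else 1

theorem late_of_reachesWithin {k : ℕ} {p : Pt × ℝ} (h : ReachesWithin c n next V S t k p) :
    late c n next V t k p S = 0 := if_pos h

theorem late_of_not_reachesWithin {k : ℕ} {p : Pt × ℝ}
    (h : ¬ ReachesWithin c n next V S t k p) : late c n next V t k p S = 1 := if_neg h

theorem late_mem_Icc (k : ℕ) (p : Pt × ℝ) : late c n next V t k p S ∈ Set.Icc (0 : ℝ) 1 := by
  unfold late
  split_ifs <;> simp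

theorem late_succ_le_late_hop (k : ℕ) (p : Pt × ℝ) :
    late c n next V t (k + 1) p S ≤ late c n next V t k (hop c n next V S t p) S := by
  by_cases h : ReachesWithin c n next V S t k (hop c n next V S t p)
  · rw [late_of_reachesWithin h, late_of_reachesWithin h.of_hop]
  · rw [late_of_not_reachesWithin h]
    exact (late_mem_Icc _ _).2

/-- The hop out of `p` depends only on shortcuts of its holder, which are not resampled; the pairs
that matter from then on are among nodes strictly closer to `t`, whence `ih` applies. -/
theorem resample_late_succ_le (hnext : IsApproxGreedy n next) (hV : HasCloserContacts c n V t)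
    (ht : t ∈ V) (ha : 0 ≤ a) {k : ℕ} {B : ℝ} (hB : 0 ≤ B)
    (ih : ∀ q, IsRoutingState c n V t q → ∀ S,
      resample (pairProb c n a) (nodePairs (insert q.1 (closerNodes n V t q.1)))
        (late c n next V t k q) S ≤ q.2 * B)
    {p : Pt × ℝ} (hp : IsRoutingState c n V t p) (hr : 8 * localRadius c n < p.2)
    (S : Finset (Sym2 Pt)) :
    resample (pairProb c n a) (nodePairs (closerNodes n V t p.1))
        (late c n next V t (k + 1) p) S ≤
      p.2 * B / 2 + p.2 * B / 2 *
        (if Disjoint ((annulusNodes n V t p.2).image fun y => s(p.1, y)) S then 1 else 0) := by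
  have hpB : 0 ≤ p.2 * B := mul_nonneg ((torusDist_nonneg _ _ _).trans hp.dist_le) hB
  set q := hop c n next V S t p with hq_def
  have h_not_mem : p.1 ∉ closerNodes n V t p.1 := fun h => lt_irrefl _ (mem_closerNodes.1 h).2
  have late_le_late_hop : resample (pairProb c n a) (nodePairs (closerNodes n V t p.1))
        (late c n next V t (k + 1) p) S ≤
      resample (pairProb c n a) (nodePairs (closerNodes n V t p.1)) (late c n next V t k q) S := by
    refine resample_mono (fun e _ => pairProb_mem_Icc ha e) fun S' hS' => ?_
    rw [hq_def, ← hop_congr fun y => hS' _ fun h => h_not_mem (mk_mem_nodePairs.1 h).1.1]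
    exact late_succ_le_late_hop k p
  refine late_le_late_hop.trans ?_
  rcases hp.hop_cases (S := S) hnext hV ht hr with hq | ⟨hq, hq_closer, hq_radius⟩
  · refine resample_le_of_forall_le (fun e _ => pairProb_mem_Icc ha e) fun S' _ => ?_
    rw [late_of_reachesWithin (.of_fst_eq hq k)]
    split_ifs <;> linarith
  · have closer_subset :
        insert q.1 (closerNodes n V t q.1) ⊆ closerNodes n V t p.1 :=
      Finset.insert_subset hq_closer (closerNodes_ssubset hq_closer).subset
    refine (resample_le_of_subset (fun e _ => pairProb_mem_Icc ha e)
      (nodePairs_mono closer_subset) (ih q hq) S).trans ?_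
    rcases hq_radius with h | ⟨h, hno⟩
    · rw [h]
      split_ifs <;> linarith
    · rw [if_pos (Finset.disjoint_left.2 <| Finset.forall_mem_image.2 fun y hy => hno y hy)]
      linarith [mul_le_mul_of_nonneg_right h hB]

theorem resample_late_insert_le (hnext : IsApproxGreedy n next) (hV : HasCloserContacts c n V t)
    (ht : t ∈ V) (ha : 0 ≤ a) {q : ℝ} (hq : HasAnnulusShortcuts c n a V t q) {k : ℕ} {B : ℝ}
    (hB : 0 ≤ B)
    (ih : ∀ q, IsRoutingState c n V t q → ∀ S,
      resample (pairProb c n a) (nodePairs (insert q.1 (closerNodes n V t q.1)))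
        (late c n next V t k q) S ≤ q.2 * B)
    {p : Pt × ℝ} (hp : IsRoutingState c n V t p) (hr : 8 * localRadius c n < p.2)
    (S : Finset (Sym2 Pt)) :
    resample (pairProb c n a) (nodePairs (insert p.1 (closerNodes n V t p.1)))
      (late c n next V t (k + 1) p) S ≤ p.2 * (B * ((1 + Real.exp (-q)) / 2)) := by
  have hpB : 0 ≤ p.2 * B / 2 :=
    div_nonneg (mul_nonneg ((torusDist_nonneg _ _ _).trans hp.dist_le) hB) zero_le_two
  have h_not_mem : p.1 ∉ closerNodes n V t p.1 := fun h => lt_irrefl _ (mem_closerNodes.1 h).2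
  have annulus_subset : annulusNodes n V t p.2 ⊆ closerNodes n V t p.1 := fun y hy => by
    rw [mem_annulusNodes] at hy
    exact mem_closerNodes.2 ⟨hy.1, hy.2.2.trans_lt (hp.half_lt hr)⟩
  have expected : q ≤ ∑ e ∈ (annulusNodes n V t p.2).image fun y => s(p.1, y),
      pairProb c n a e := by
    rw [Finset.sum_image fun y _ z _ h => Sym2.congr_right.1 h]
    exact hq p.1 hp.mem p.2 hr (hp.half_lt hr) hp.dist_le
  rw [nodePairs_insert h_not_mem, resample_union (disjoint_star_nodePairs h_not_mem)]
  calc _ ≤ p.2 * B / 2 + p.2 * B / 2 * resample (pairProb c n a)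
          ((closerNodes n V t p.1).image fun y => s(p.1, y))
          (fun S => if Disjoint ((annulusNodes n V t p.2).image fun y => s(p.1, y)) S
            then 1 else 0) S := by
        rw [← resample_add_mul]
        exact resample_mono (fun e _ => pairProb_mem_Icc ha e) fun S' _ =>
          resample_late_succ_le hnext hV ht ha hB ih hp hr S'
    _ ≤ p.2 * B / 2 + p.2 * B / 2 * Real.exp (-q) := by
        gcongr
        exact (resample_disjoint_le (Finset.image_subset_image annulus_subset)
          (fun e _ => (pairProb_mem_Icc ha e).2) S).trans (by gcongr)
    _ = _ := by ring

theorem resample_late_le (hnext : IsApproxGreedy n next) (hV : HasCloserContacts c n V t)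
    (ht : t ∈ V) (hR : 0 < localRadius c n) {N : ℕ}
    (hN : (V.filter fun y => torusDist √n y t ≤ 8 * localRadius c n).card ≤ N)
    (ha : 0 ≤ a) {q : ℝ} (hq : HasAnnulusShortcuts c n a V t q) (k : ℕ) {p : Pt × ℝ}
    (hp : IsRoutingState c n V t p) (S : Finset (Sym2 Pt)) :
    resample (pairProb c n a) (nodePairs (insert p.1 (closerNodes n V t p.1)))
        (late c n next V t (5 * N + 5 + k) p) S ≤
      p.2 * (1 / localRadius c n * ((1 + Real.exp (-q)) / 2) ^ k) := by
  have hB (k : ℕ) : 0 ≤ 1 / localRadius c n * ((1 + Real.exp (-q)) / 2) ^ k := by positivity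
  have hp0 : 0 ≤ p.2 := (torusDist_nonneg _ _ _).trans hp.dist_le
  induction k generalizing p S with
  | zero =>
    refine resample_le_of_forall_le (fun e _ => pairProb_mem_Icc ha e) fun S' _ => ?_
    rcases le_or_gt p.2 (8 * localRadius c n) with hr | hr
    · rw [late_of_reachesWithin
        (reachesWithin_of_radius_le hnext hV ht hR hN hp.mem hp.dist_le hr)]
      exact mul_nonneg hp0 (hB 0)
    · refine (late_mem_Icc _ _).2.trans ?_
      rw [pow_zero, mul_one, mul_one_div, one_le_div hR]
      linarith
  | succ k ih =>
    rcases le_or_gt p.2 (8 * localRadius c n) with hr | hr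
    · refine resample_le_of_forall_le (fun e _ => pairProb_mem_Icc ha e) fun S' _ => ?_
      rw [late_of_reachesWithin (.mono (Nat.le_add_right _ _)
        (reachesWithin_of_radius_le hnext hV ht hR hN hp.mem hp.dist_le hr))]
      exact mul_nonneg hp0 (hB _)
    · rw [pow_succ, ← mul_assoc (1 / _)]
      exact resample_late_insert_le hnext hV ht ha hq (hB k)
        (fun q hq S => ih hq S ((torusDist_nonneg _ _ _).trans hq.dist_le)) hp hr S

theorem sum_shortcutWeight_eq_resample (V : Finset Pt) (E : Finset (Sym2 Pt) → Prop)
    [DecidablePred E] :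
    ∑ S ∈ (nodePairs V).powerset.filter E, shortcutWeight c n a V S =
      resample (pairProb c n a) (nodePairs V) (fun S => if E S then 1 else 0) ∅ := by
  rw [resample, Finset.sum_filter]
  refine Finset.sum_congr rfl fun S _ => ?_
  simp only [Finset.empty_sdiff, Finset.empty_union, shortcutWeight]
  split_ifs <;> simp

theorem sum_shortcutWeight_le_one (ha : 0 ≤ a) (V : Finset Pt) (E : Finset (Sym2 Pt) → Prop)
    [DecidablePred E] :
    ∑ S ∈ (nodePairs V).powerset.filter E, shortcutWeight c n a V S ≤ 1 := by
  rw [sum_shortcutWeight_eq_resample]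
  refine resample_le_of_forall_le (fun e _ => pairProb_mem_Icc ha e) fun S _ => ?_
  split_ifs <;> norm_num

theorem pos_of_localRadius_pos (hR : 0 < localRadius c n) : 0 < n := by
  refine Nat.pos_of_ne_zero fun h => hR.ne' ?_
  rw [localRadius, h, Nat.cast_zero, Real.log_zero, mul_zero, Real.sqrt_zero]

theorem resample_late_initial_le (hnext : IsApproxGreedy n next) (hV : HasCloserContacts c n V t)
    (ht : t ∈ V) (hR : 0 < localRadius c n) {N : ℕ}
    (hN : (V.filter fun y => torusDist √n y t ≤ 8 * localRadius c n).card ≤ N)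
    (ha : 0 ≤ a) {q : ℝ} (hq : HasAnnulusShortcuts c n a V t q) (k : ℕ) {s : Pt} (hs : s ∈ V)
    (S : Finset (Sym2 Pt)) :
    resample (pairProb c n a) (nodePairs V)
        (late c n next V t (5 * N + 5 + k) (s, torusDist √n s t)) S ≤
      √n / localRadius c n * ((1 + Real.exp (-q)) / 2) ^ k := by
  have hL : 0 < √(n : ℝ) := Real.sqrt_pos.2 (Nat.cast_pos.2 (pos_of_localRadius_pos hR))
  have start : IsRoutingState c n V t (s, torusDist √n s t) :=
    ⟨hs, le_rfl, fun _ => half_lt_self (by linarith)⟩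
  have subset : nodePairs (insert s (closerNodes n V t s)) ⊆ nodePairs V :=
    nodePairs_mono (Finset.insert_subset hs (Finset.filter_subset _ _))
  refine (resample_le_of_subset (fun e _ => pairProb_mem_Icc ha e) subset
    (fun S => resample_late_le hnext hV ht hR hN ha hq k start S) S).trans ?_
  change torusDist √n s t * _ ≤ _
  rw [← mul_assoc, mul_one_div]
  have := torusDist_le_period hL s t
  gcongr

/-- The event that the messages between any two nodes are delivered within `K` hops. -/
def AllDeliveredWithin (c : ℝ) (n : ℕ) (next : View → Pt) (K : ℝ) (V : Finset Pt)
    (S : Finset (Sym2 Pt)) : Prop :=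
  ∀ s ∈ V, ∀ t ∈ V, DeliveredWithin c n next V S s t K

theorem le_sum_shortcutWeight_allDeliveredWithin (hnext : IsApproxGreedy n next)
    (hR : 0 < localRadius c n) (ha : 0 ≤ a) {N : ℕ} {q K : ℝ}
    (hV : ∀ t ∈ V, HasCloserContacts c n V t)
    (hN : ∀ t ∈ V, (V.filter fun y => torusDist √n y t ≤ 8 * localRadius c n).card ≤ N)
    (hq : ∀ t ∈ V, HasAnnulusShortcuts c n a V t q) {k : ℕ} (hK : (5 * N + 5 + k : ℕ) ≤ K)
    [DecidablePred (AllDeliveredWithin c n next K V)] :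
    1 - V.card ^ 2 * (√n / localRadius c n * ((1 + Real.exp (-q)) / 2) ^ k) ≤
      ∑ S ∈ (nodePairs V).powerset.filter (AllDeliveredWithin c n next K V),
        shortcutWeight c n a V S := by
  set lateMessage : Pt × Pt → Finset (Sym2 Pt) → ℝ := fun st =>
    late c n next V st.2 (5 * N + 5 + k) (st.1, torusDist √n st.1 st.2)
  have union_bound : ∀ S, 1 + -1 * ∑ st ∈ V ×ˢ V, lateMessage st S ≤
      if AllDeliveredWithin c n next K V S then 1 else 0 := by
    intro S
    have nonneg (st : Pt × Pt) : 0 ≤ lateMessage st S := (late_mem_Icc _ _).1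
    split_ifs with h
    · linarith [Finset.sum_nonneg fun st (_ : st ∈ V ×ˢ V) => nonneg st]
    · unfold AllDeliveredWithin at h
      push Not at h
      obtain ⟨s, hs, t, ht, h⟩ := h
      have late_st : lateMessage (s, t) S = 1 := late_of_not_reachesWithin fun ⟨j, hj, hjt⟩ =>
        h ⟨j, (Nat.cast_le.2 hj).trans hK, hjt⟩
      linarith [Finset.single_le_sum (f := fun st => lateMessage st S) (fun st _ => nonneg st)
        (Finset.mk_mem_product hs ht)]
  have late_le : ∑ st ∈ V ×ˢ V, resample (pairProb c n a) (nodePairs V) (lateMessage st) ∅ ≤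
      V.card ^ 2 * (√n / localRadius c n * ((1 + Real.exp (-q)) / 2) ^ k) := by
    rw [sq, ← Nat.cast_mul, ← Finset.card_product, ← nsmul_eq_mul]
    refine Finset.sum_le_card_nsmul _ _ _ fun st hst => ?_
    obtain ⟨hs, ht⟩ := Finset.mem_product.1 hst
    exact resample_late_initial_le hnext (hV _ ht) ht hR (hN _ ht) ha (hq _ ht) k hs ∅
  rw [sum_shortcutWeight_eq_resample]
  refine le_trans ?_ (resample_mono (fun e _ => pairProb_mem_Icc ha e) fun S _ => union_bound S)
  rw [resample_add_mul, resample_sum]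
  linarith

end Delivery

/-! ### Poisson samples -/

section PoissonSampling

variable {α : Type*} [MeasurableSpace α]

theorem lintegral_poissonMeasure (r : ℝ≥0) (f : ℕ → ℝ≥0∞) :
    ∫⁻ N, f N ∂(poissonMeasure r) =
      ∑' N : ℕ, ENNReal.ofReal (Real.exp (-r) * r ^ N / (N.factorial : ℝ)) * f N := by
  rw [poissonMeasure, lintegral_sum_measure]
  simp [lintegral_smul_measure]

theorem lintegral_pow_poissonMeasure (r : ℝ≥0) {s : ℝ} (hs : 0 ≤ s) :
    ∫⁻ N, ENNReal.ofReal s ^ N ∂(poissonMeasure r) = ENNReal.ofReal (Real.exp (r * (s - 1))) := by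
  have h : HasSum (fun N : ℕ => Real.exp (-r) * r ^ N / (N.factorial : ℝ) * s ^ N)
      (Real.exp (r * (s - 1))) := by
    convert! (NormedSpace.expSeries_div_hasSum_exp (r * s : ℝ)).mul_left (Real.exp (-r)) using 1
    · ext N
      rw [mul_pow]
      ring
    · rw [← Real.exp_eq_exp_ℝ, ← Real.exp_add]
      congr 1
      ring
  rw [lintegral_poissonMeasure, ← h.tsum_eq,
    ENNReal.ofReal_tsum_of_nonneg (fun N => by positivity) h.summable]
  refine tsum_congr fun N => ?_
  rw [ENNReal.ofReal_mul (by positivity), ENNReal.ofReal_pow hs]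

theorem lintegral_id_poissonMeasure (r : ℝ≥0) :
    ∫⁻ N, (N : ℝ≥0∞) ∂(poissonMeasure r) = r := by
  have h : HasSum (fun N : ℕ => Real.exp (-r) * r ^ N / (N.factorial : ℝ) * N) r := by
    rw [← hasSum_nat_add_iff' 1]
    convert! (hasSum_one_poissonMeasure r).mul_left (r : ℝ) using 1
    · ext N
      rw [Nat.factorial_succ]
      push_cast
      field_simp
      ring
    · simp
  rw [lintegral_poissonMeasure, ← ENNReal.ofReal_coe_nnreal (p := r)]
  conv_rhs => rw [← h.tsum_eq, ENNReal.ofReal_tsum_of_nonneg (fun N => by positivity) h.summable]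
  refine tsum_congr fun N => ?_
  rw [ENNReal.ofReal_mul (by positivity), ENNReal.ofReal_natCast]

/-- Poisson(`r`) many independent points with law `μ`, encoded as in `nodeLaw`: the number of
points, and an infinite sequence of which only that many terms are used. -/
noncomputable def poissonSample (r : ℝ≥0) (μ : Measure α) : Measure (ℕ × (ℕ → α)) :=
  (poissonMeasure r).prod (Measure.infinitePi fun _ => μ)

theorem nodeLaw_eq_poissonSample (n : ℕ) : nodeLaw n = poissonSample n volume := rfl

variable (r : ℝ≥0) (μ : Measure α) [IsProbabilityMeasure μ]

instance isProbabilityMeasure_poissonSample : IsProbabilityMeasure (poissonSample r μ) := by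
  unfold poissonSample
  infer_instance

theorem lintegral_poissonSample {f : ℕ × (ℕ → α) → ℝ≥0∞} (hf : ∀ N, Measurable fun u => f (N, u)) :
    ∫⁻ ω, f ω ∂(poissonSample r μ) =
      ∫⁻ N, ∫⁻ u, f (N, u) ∂(Measure.infinitePi fun _ => μ) ∂(poissonMeasure r) := by
  rw [poissonSample, lintegral_prod _ (measurable_from_prod_countable_right hf).aemeasurable]

theorem lintegral_eval_infinitePi {g : α → ℝ≥0∞} (hg : Measurable g) (i : ℕ) :
    ∫⁻ u, g (u i) ∂(Measure.infinitePi fun _ => μ) = ∫⁻ x, g x ∂μ :=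
  (measurePreserving_eval_infinitePi (fun _ : ℕ => μ) i).lintegral_comp hg

theorem lintegral_prod_poissonSample {g : α → ℝ≥0∞} (hg : Measurable g) {s : ℝ} (hs : 0 ≤ s)
    (hgs : ∫⁻ x, g x ∂μ = ENNReal.ofReal s) :
    ∫⁻ ω, ∏ i ∈ Finset.range ω.1, g (ω.2 i) ∂(poissonSample r μ) =
      ENNReal.ofReal (Real.exp (r * (s - 1))) := by
  have hind : iIndepFun (fun i (u : ℕ → α) => g (u i)) (Measure.infinitePi fun _ => μ) :=
    iIndepFun_infinitePi (X := fun _ => g) fun _ => hg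
  rw [lintegral_poissonSample r μ fun N => by
    dsimp only; fun_prop,
    ← lintegral_pow_poissonMeasure r hs]
  refine lintegral_congr fun N => ?_
  rw [lintegral_prod_eq_prod_lintegral_of_indepFun (Finset.range N) _ hind fun i => by fun_prop]
  simp only [lintegral_eval_infinitePi μ hg, hgs, Finset.prod_const, Finset.card_range]

theorem lintegral_sum_poissonSample {g : α → ℝ≥0∞} (hg : Measurable g) :
    ∫⁻ ω, ∑ i ∈ Finset.range ω.1, g (ω.2 i) ∂(poissonSample r μ) = r * ∫⁻ x, g x ∂μ := by
  rw [lintegral_poissonSample r μ fun N => by dsimp only; fun_prop]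
  have hN (N : ℕ) : ∫⁻ u, ∑ i ∈ Finset.range N, g (u i) ∂(Measure.infinitePi fun _ => μ) =
      N * ∫⁻ x, g x ∂μ := by
    rw [lintegral_finsetSum _ fun i _ => by fun_prop]
    simp only [lintegral_eval_infinitePi μ hg, Finset.sum_const, Finset.card_range, nsmul_eq_mul]
  simp only [hN]
  rw [lintegral_mul_const _ (by fun_prop), lintegral_id_poissonMeasure]

open Classical in
/-- The number of sample points in `B`, with multiplicity. -/
noncomputable def indexCount (B : Set α) (ω : ℕ × (ℕ → α)) : ℕ :=
  ((Finset.range ω.1).filter fun i => ω.2 i ∈ B).card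

theorem measurable_indexCount {B : Set α} (hB : MeasurableSet B) :
    Measurable (indexCount B) := by
  classical
  refine measurable_from_prod_countable_right fun N => ?_
  simp only [indexCount, Finset.card_filter]
  exact Finset.measurable_fun_sum _ fun i _ =>
    Measurable.ite (measurable_pi_apply i hB) measurable_const measurable_const

theorem lintegral_exp_indexCount {B : Set α} (hB : MeasurableSet B) (σ : ℝ) :
    ∫⁻ ω, ENNReal.ofReal (Real.exp (σ * indexCount B ω)) ∂(poissonSample r μ) =
      ENNReal.ofReal (Real.exp (r * (μ.real B * (Real.exp σ - 1)))) := by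
  classical
  have hB1 : μ.real B ≤ 1 := measureReal_le_one
  have hB0 : 0 ≤ μ.real B := measureReal_nonneg
  set g : α → ℝ≥0∞ := fun x => ENNReal.ofReal (if x ∈ B then Real.exp σ else 1) with hg
  have hgm : Measurable g :=
    ENNReal.measurable_ofReal.comp (Measurable.ite hB measurable_const measurable_const)
  have hgi : g = fun x => B.indicator (fun _ => ENNReal.ofReal (Real.exp σ)) x +
      Bᶜ.indicator (fun _ => 1) x := by
    ext x
    by_cases hx : x ∈ B <;> simp [hg, hx]
  have hgs : ∫⁻ x, g x ∂μ = ENNReal.ofReal (1 + μ.real B * (Real.exp σ - 1)) := by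
    rw [hgi, lintegral_add_left (measurable_const.indicator hB), lintegral_indicator_const hB,
      lintegral_indicator_const hB.compl, one_mul, ← ofReal_measureReal, ← ofReal_measureReal,
      measureReal_compl hB, probReal_univ, ← ENNReal.ofReal_mul (by positivity),
      ← ENNReal.ofReal_add (by positivity) (by linarith)]
    congr 1
    ring
  have hprod (ω : ℕ × (ℕ → α)) : ENNReal.ofReal (Real.exp (σ * indexCount B ω)) =
      ∏ i ∈ Finset.range ω.1, g (ω.2 i) := by
    rw [← ENNReal.ofReal_prod_of_nonneg fun i _ => by split_ifs <;> positivity, Finset.prod_ite,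
      Finset.prod_const, Finset.prod_const_one, mul_one, ← Real.exp_nat_mul, mul_comm, indexCount]
  simp only [hprod]
  rw [lintegral_prod_poissonSample r μ hgm (by nlinarith [Real.exp_pos σ]) hgs, add_sub_cancel_left]

theorem poissonSample_le_mul_indexCount {B : Set α} (hB : MeasurableSet B) (σ b : ℝ) :
    poissonSample r μ {ω | b ≤ σ * indexCount B ω} ≤
      ENNReal.ofReal (Real.exp (r * (μ.real B * (Real.exp σ - 1)) - b)) := by
  have hm : Measurable fun ω : ℕ × (ℕ → α) =>
      ENNReal.ofReal (Real.exp (σ * indexCount B ω)) := by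
    have := measurable_indexCount hB
    fun_prop
  have h := mul_meas_ge_le_lintegral hm (μ := poissonSample r μ) (ENNReal.ofReal (Real.exp b))
  simp only [lintegral_exp_indexCount r μ hB, ENNReal.ofReal_le_ofReal_iff (Real.exp_pos _).le,
    Real.exp_le_exp] at h
  rwa [Real.exp_sub, ENNReal.ofReal_div_of_pos (Real.exp_pos _),
    ENNReal.le_div_iff_mul_le (by simp [Real.exp_pos]) (by simp), mul_comm]

theorem poissonSample_le_indexCount {B : Set α} (hB : MeasurableSet B) (b : ℝ) :
    poissonSample r μ {ω | b ≤ indexCount B ω} ≤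
      ENNReal.ofReal (Real.exp (2 * (r * μ.real B) - b)) := by
  have h := poissonSample_le_mul_indexCount r μ hB 1 b
  simp only [one_mul] at h
  refine h.trans (ENNReal.ofReal_le_ofReal (Real.exp_le_exp.2 ?_))
  have he : Real.exp 1 - 1 ≤ 2 := by linarith [Real.exp_one_lt_three]
  have : 0 ≤ r * μ.real B := by positivity
  nlinarith

theorem poissonSample_indexCount_le {B : Set α} (hB : MeasurableSet B) :
    poissonSample r μ {ω | (indexCount B ω : ℝ) ≤ r * μ.real B / 4} ≤
      ENNReal.ofReal (Real.exp (-(r * μ.real B / 4))) := by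
  have h := poissonSample_le_mul_indexCount r μ hB (-1) (-(r * μ.real B / 4))
  simp only [neg_mul, one_mul, neg_le_neg_iff] at h
  refine h.trans (ENNReal.ofReal_le_ofReal (Real.exp_le_exp.2 ?_))
  have he : Real.exp (-1) ≤ 1 / 2 := by
    rw [Real.exp_neg, one_div]
    exact inv_anti₀ two_pos (by linarith [Real.add_one_le_exp (1 : ℝ)])
  have : 0 ≤ r * μ.real B := by positivity
  nlinarith

theorem ae_eval_ne_infinitePi [NullSingletonClass μ] [MeasurableEq α] {i j : ℕ} (hij : i ≠ j) :
    ∀ᵐ u ∂(Measure.infinitePi fun _ => μ), u i ≠ u j := by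
  have hd : MeasurableSet {z : α × α | z.1 = z.2} :=
    measurableSet_eq_fun measurable_fst measurable_snd
  have hslice (x : α) : Prod.mk x ⁻¹' {z : α × α | z.1 = z.2} = {x} := by
    ext y
    simp [eq_comm]
  have hdiag : (μ.prod μ) {z | z.1 = z.2} = 0 := by
    simp [Measure.prod_apply hd, hslice]
  rw [← Measure.infinitePi_map_eval_prod (P := fun _ : ℕ => μ) hij,
    Measure.map_apply (by fun_prop) hd] at hdiag
  simpa only [ae_iff, not_not, ne_eq, Set.preimage_ofPred_eq] using hdiag

theorem ae_injective_poissonSample [NullSingletonClass μ] [MeasurableEq α] :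
    ∀ᵐ ω ∂(poissonSample r μ), Function.Injective ω.2 := by
  have h : ∀ᵐ u ∂(Measure.infinitePi fun _ : ℕ => μ), Function.Injective u := by
    have hne : ∀ᵐ u ∂(Measure.infinitePi fun _ => μ), ∀ i j : ℕ, i ≠ j → u i ≠ u j :=
      ae_all_iff.2 fun _ => ae_all_iff.2 fun _ => ae_all_iff.2 fun hij =>
        ae_eval_ne_infinitePi μ hij
    filter_upwards [hne] with u hu i j
    exact not_imp_not.1 (hu i j)
  exact Measure.quasiMeasurePreserving_snd.ae h

end PoissonSampling

/-! ### Cells and discs -/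

section Regions

/-- The location in `[0, √n]²` of a point of the unit square. -/
noncomputable def location (n : ℕ) (u : unitInterval × unitInterval) : Pt :=
  (√n * (u.1 : ℝ), √n * (u.2 : ℝ))

open Classical in
theorem nodeSet_eq_image_location (n : ℕ) (ω : NodeSpace) :
    nodeSet n ω = (Finset.range ω.1).image fun i => location n (ω.2 i) := rfl

theorem location_injective {n : ℕ} (hn : 0 < n) : Function.Injective (location n) := by
  have hL : √(n : ℝ) ≠ 0 := (Real.sqrt_pos.2 (Nat.cast_pos.2 hn)).ne'
  intro u v h
  simp only [location, Prod.mk.injEq, mul_right_inj' hL] at h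
  exact Prod.ext (Subtype.ext h.1) (Subtype.ext h.2)

theorem card_filter_nodeSet_le (n : ℕ) (ω : NodeSpace) {P : Pt → Prop} [DecidablePred P]
    {B : Set (unitInterval × unitInterval)} (h : ∀ u, P (location n u) → u ∈ B) :
    ((nodeSet n ω).filter P).card ≤ indexCount B ω := by
  classical
  rw [nodeSet_eq_image_location, Finset.filter_image]
  exact Finset.card_image_le.trans
    (Finset.card_le_card (Finset.monotone_filter_right _ fun i _ hi => h _ hi))

theorem indexCount_le_card_filter_nodeSet {n : ℕ} (hn : 0 < n) {ω : NodeSpace}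
    (hω : Function.Injective ω.2) {P : Pt → Prop} [DecidablePred P]
    {B : Set (unitInterval × unitInterval)} (h : ∀ u ∈ B, P (location n u)) :
    indexCount B ω ≤ ((nodeSet n ω).filter P).card := by
  classical
  have hinj : Function.Injective fun i => location n (ω.2 i) := (location_injective hn).comp hω
  rw [nodeSet_eq_image_location, Finset.filter_image, Finset.card_image_of_injective _ hinj]
  exact Finset.card_le_card (Finset.monotone_filter_right _ fun i _ hi => h _ hi)

/-- The cell in row `j` and column `i` of the division of the unit square into `M²` squares. -/
def cell (M i j : ℕ) : Set (unitInterval × unitInterval) :=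
  (Subtype.val ⁻¹' Set.Ico ((i : ℝ) / M) ((i + 1) / M)) ×ˢ
    (Subtype.val ⁻¹' Set.Ico ((j : ℝ) / M) ((j + 1) / M))

theorem measurableSet_cell (M i j : ℕ) : MeasurableSet (cell M i j) :=
  (measurable_subtype_coe measurableSet_Ico).prod (measurable_subtype_coe measurableSet_Ico)

theorem volume_coe_preimage_Ico {M i : ℕ} (hi : i < M) :
    volume ((Subtype.val : unitInterval → ℝ) ⁻¹' Set.Ico ((i : ℝ) / M) ((i + 1) / M)) =
      ENNReal.ofReal (1 / M) := by
  have hM : (0 : ℝ) < M := Nat.cast_pos.2 (Nat.zero_lt_of_lt hi)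
  have hi' : (i : ℝ) + 1 ≤ M := by exact_mod_cast hi
  have hsub : Set.Ico ((i : ℝ) / M) ((i + 1) / M) ⊆ unitInterval := fun y hy =>
    ⟨le_trans (by positivity) hy.1, hy.2.le.trans ((div_le_one hM).2 hi')⟩
  rw [unitInterval.measurePreserving_coe.measure_preimage measurableSet_Ico.nullMeasurableSet,
    Measure.restrict_apply measurableSet_Ico, Set.inter_eq_left.2 hsub, Real.volume_Ico]
  congr 1
  ring

theorem measureReal_cell {M i j : ℕ} (hi : i < M) (hj : j < M) :
    volume.real (cell M i j) = 1 / (M : ℝ) ^ 2 := by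
  rw [measureReal_def, cell, Measure.volume_eq_prod, Measure.prod_prod, volume_coe_preimage_Ico hi,
    volume_coe_preimage_Ico hj, ← ENNReal.ofReal_mul (by positivity),
    ENNReal.toReal_ofReal (by positivity)]
  ring

theorem exists_Ico_norm_coe_sub_le {L : ℝ} (hL : 0 < L) {M : ℕ} (hM : 0 < M) (q : ℝ) :
    ∃ i < M, ∀ x ∈ Set.Ico ((i : ℝ) / M) ((i + 1) / M),
      ‖((L * x - q : ℝ) : AddCircle L)‖ ≤ L / M := by
  have hM' : (0 : ℝ) < M := Nat.cast_pos.2 hM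
  set v := Int.fract (q / L)
  have hv0 : 0 ≤ v * M := mul_nonneg (Int.fract_nonneg _) hM'.le
  have hfloor : (⌊v * M⌋₊ : ℝ) / M ≤ v := (div_le_iff₀ hM').2 (Nat.floor_le hv0)
  have hceil : v < (⌊v * M⌋₊ + 1) / M := (lt_div_iff₀ hM').2 (Nat.lt_floor_add_one _)
  refine ⟨⌊v * M⌋₊, (Nat.floor_lt hv0).2 (mul_lt_of_lt_one_left hM' (Int.fract_lt_one _)),
    fun x hx => ?_⟩
  have hcoe : ((L * x - q : ℝ) : AddCircle L) = ((L * (x - v) : ℝ) : AddCircle L) := by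
    have hq : L * x - q = L * (x - v) - ⌊q / L⌋ • L := by
      rw [zsmul_eq_mul]
      linear_combination L * Int.floor_add_fract (q / L) + mul_div_cancel₀ q hL.ne'
    rw [hq, AddCircle.coe_sub, AddCircle.coe_zsmul, AddCircle.coe_period, smul_zero, sub_zero]
  have habs : |x - v| ≤ 1 / M := by
    rw [add_div] at hx hceil
    rw [abs_le]
    constructor <;> linarith [hx.1, hx.2]
  calc _ ≤ |L * (x - v)| := hcoe ▸ norm_coe_le_abs L _
    _ = L * |x - v| := by rw [abs_mul, abs_of_pos hL]
    _ ≤ L * (1 / M) := by gcongr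
    _ = L / M := mul_one_div _ _

theorem exists_cell_torusDist_le {L : ℝ} (hL : 0 < L) {M : ℕ} (hM : 0 < M) (z : Pt) :
    ∃ i < M, ∃ j < M, ∀ x ∈ Set.Ico ((i : ℝ) / M) ((i + 1) / M),
      ∀ y ∈ Set.Ico ((j : ℝ) / M) ((j + 1) / M), torusDist L (L * x, L * y) z ≤ 2 * (L / M) := by
  obtain ⟨i, hi, hx⟩ := exists_Ico_norm_coe_sub_le hL hM z.1
  obtain ⟨j, hj, hy⟩ := exists_Ico_norm_coe_sub_le hL hM z.2
  exact ⟨i, hi, j, hj, fun x hxi y hyj => torusDist_le_of_norm_le (hx x hxi) (hy y hyj)⟩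

/-- The part of the unit square whose locations are within torus distance `ρ` of `z`. -/
def discRegion (n : ℕ) (z : Pt) (ρ : ℝ) : Set (unitInterval × unitInterval) :=
  {u | torusDist √n (location n u) z ≤ ρ}

theorem measurableSet_discRegion (n : ℕ) (z : Pt) (ρ : ℝ) : MeasurableSet (discRegion n z ρ) := by
  have hloc : Continuous (location n) := by
    unfold location
    fun_prop
  have hdist : Continuous fun u => torusDist √n (location n u) z := by
    simp only [torusDist_eq_dist]
    exact ((continuous_toTorus _).comp hloc).dist continuous_const
  exact (isClosed_le hdist continuous_const).measurableSet

theorem measurePreserving_coe_unitAddCircle :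
    MeasurePreserving fun u : unitInterval => ((u : ℝ) : UnitAddCircle) := by
  have hmk := UnitAddCircle.measurePreserving_mk 0
  rw [zero_add, Measure.restrict_congr_set Ioc_ae_eq_Icc] at hmk
  exact hmk.comp unitInterval.measurePreserving_coe

theorem volume_arc_le {L : ℝ} (hL : 0 < L) (q ρ : ℝ) :
    volume {u : unitInterval | ‖((L * u - q : ℝ) : AddCircle L)‖ ≤ ρ} ≤
      ENNReal.ofReal (2 * ρ / L) := by
  have hscale (x : ℝ) : ‖((L * x : ℝ) : AddCircle L)‖ = L * ‖(x : UnitAddCircle)‖ := by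
    have := AddCircle.norm_coe_mul 1 x L
    rwa [mul_one, abs_of_pos hL] at this
  have harc : {u : unitInterval | ‖((L * u - q : ℝ) : AddCircle L)‖ ≤ ρ} =
      (fun u : unitInterval => ((u : ℝ) : UnitAddCircle)) ⁻¹'
        Metric.closedBall ((q / L : ℝ) : UnitAddCircle) (ρ / L) := by
    ext u
    rw [Set.mem_preimage, Metric.mem_closedBall, dist_eq_norm, ← AddCircle.coe_sub,
      le_div_iff₀' hL, ← hscale, mul_sub, mul_div_cancel₀ _ hL.ne']
    rfl
  rw [harc, measurePreserving_coe_unitAddCircle.measure_preimage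
    measurableSet_closedBall.nullMeasurableSet, AddCircle.volume_closedBall]
  exact ENNReal.ofReal_le_ofReal ((min_le_right _ _).trans_eq (mul_div_assoc _ _ _).symm)

theorem measureReal_discRegion_le {n : ℕ} (hn : 0 < n) (z : Pt) {ρ : ℝ} (hρ : 0 ≤ ρ) :
    volume.real (discRegion n z ρ) ≤ 4 * ρ ^ 2 / n := by
  have hL : 0 < √(n : ℝ) := Real.sqrt_pos.2 (Nat.cast_pos.2 hn)
  have hsub : discRegion n z ρ ⊆
      {u : unitInterval | ‖((√n * u - z.1 : ℝ) : AddCircle √(n : ℝ))‖ ≤ ρ} ×ˢ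
      {u : unitInterval | ‖((√n * u - z.2 : ℝ) : AddCircle √(n : ℝ))‖ ≤ ρ} := by
    intro u hu
    have hu' : torusDist √n (location n u) z ≤ ρ := hu
    have h₁ := norm_fst_sub_le_torusDist √n (location n u) z
    have h₂ := norm_snd_sub_le_torusDist √n (location n u) z
    exact ⟨h₁.trans hu', h₂.trans hu'⟩
  rw [measureReal_def]
  refine ENNReal.toReal_le_of_le_ofReal (by positivity) ?_
  calc volume (discRegion n z ρ) ≤ ENNReal.ofReal (2 * ρ / √n) * ENNReal.ofReal (2 * ρ / √n) := by
        refine (measure_mono hsub).trans ?_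
        rw [Measure.volume_eq_prod, Measure.prod_prod]
        exact mul_le_mul' (volume_arc_le hL _ _) (volume_arc_le hL _ _)
    _ = ENNReal.ofReal (4 * ρ ^ 2 / n) := by
        rw [← ENNReal.ofReal_mul (by positivity), div_mul_div_comm,
          Real.mul_self_sqrt (Nat.cast_nonneg n)]
        congr 2
        ring

end Regions

/-! ### Density of the nodes -/

section Density

variable {c : ℝ} {n : ℕ} {ω : NodeSpace}

theorem localRadius_sq (hc : 0 ≤ c) (n : ℕ) : localRadius c n ^ 2 = c * Real.log n :=
  Real.sq_sqrt (mul_nonneg hc (Real.log_natCast_nonneg n))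

theorem one_le_log_natCast (hn : 3 ≤ n) : 1 ≤ Real.log n :=
  (Real.le_log_iff_exp_le (by positivity)).2
    (Real.exp_one_lt_three.le.trans (by exact_mod_cast hn))

theorem one_le_localRadius (hc : 1 ≤ c) (hn : 3 ≤ n) : 1 ≤ localRadius c n :=
  Real.one_le_sqrt.2 (one_le_mul_of_one_le_of_one_le hc (one_le_log_natCast hn))

/-- The number of cells along a side of the finest grid that is used: its cells have side about an
eighth of the local radius. -/
noncomputable def gridSize (c : ℝ) (n : ℕ) : ℕ := ⌈8 * √n / localRadius c n⌉₊

/-- The location of a corner of the cell `cell (gridSize c n) i j`. -/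
noncomputable def gridPoint (c : ℝ) (n i j : ℕ) : Pt :=
  (√n * (i / gridSize c n), √n * (j / gridSize c n))

theorem gridSize_pos (hR : 0 < localRadius c n) : 0 < gridSize c n :=
  Nat.ceil_pos.2 (div_pos (mul_pos (by norm_num)
    (Real.sqrt_pos.2 (Nat.cast_pos.2 (pos_of_localRadius_pos hR)))) hR)

theorem sqrt_div_gridSize_le (hR : 0 < localRadius c n) :
    √n / gridSize c n ≤ localRadius c n / 8 := by
  have h : 8 * √n / localRadius c n ≤ gridSize c n := Nat.le_ceil _
  rw [div_le_iff₀ hR] at h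
  rw [div_le_iff₀ (Nat.cast_pos.2 (gridSize_pos hR))]
  linarith

theorem gridSize_mul_localRadius_le (hR : 0 < localRadius c n) (hRn : localRadius c n ≤ √n) :
    gridSize c n * localRadius c n ≤ 9 * √n := by
  have hlt : (gridSize c n : ℝ) < 8 * √n / localRadius c n + 1 :=
    Nat.ceil_lt_add_one (by positivity)
  have hmul := mul_le_mul_of_nonneg_right hlt.le hR.le
  rw [add_mul, div_mul_cancel₀ _ hR.ne'] at hmul
  linarith

theorem gridSize_le (hn : 81 ≤ n) (hR : 1 ≤ localRadius c n) (hRn : localRadius c n ≤ √n) :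
    gridSize c n ≤ n := by
  have hsqrt : (9 : ℝ) ≤ √n := Real.le_sqrt_of_sq_le (by norm_num; exact_mod_cast hn)
  have h : (gridSize c n : ℝ) ≤ n :=
    calc (gridSize c n : ℝ) ≤ gridSize c n * localRadius c n :=
          le_mul_of_one_le_right (Nat.cast_nonneg _) hR
      _ ≤ 9 * √n := gridSize_mul_localRadius_le (by linarith) hRn
      _ ≤ √n * √n := by gcongr
      _ = n := Real.mul_self_sqrt (Nat.cast_nonneg n)
  exact_mod_cast h

/-- A node configuration that is as dense as expected, up to constant factors, on all squares and
discs that are not too small. -/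
structure WellSpread (c : ℝ) (n : ℕ) (ω : NodeSpace) : Prop where
  injective : Function.Injective ω.2
  cell_lt : ∀ M ∈ Finset.Icc 1 (gridSize c n), ∀ i < M, ∀ j < M,
    (n : ℝ) / (4 * M ^ 2) < indexCount (cell M i j) ω
  disc_lt : ∀ i < gridSize c n, ∀ j < gridSize c n,
    (indexCount (discRegion n (gridPoint c n i j) (9 * localRadius c n)) ω : ℝ) <
      650 * localRadius c n ^ 2
  count_lt : (ω.1 : ℝ) < 4 * n

theorem le_shortcutProb {a b ρ : ℝ} {x y : Pt} (hR : 1 ≤ localRadius c n) (hb : 0 ≤ b)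
    (hb1 : b ≤ 1) (hba : b ≤ a) (hxy : localRadius c n < torusDist √n x y)
    (hρ : torusDist √n x y ≤ ρ) : b / ρ ^ 2 ≤ shortcutProb c n a x y := by
  have hd : 0 < torusDist √n x y := by linarith
  rw [shortcutProb, if_pos hxy]
  have ha := hb.trans hba
  refine le_min (by gcongr) (div_le_one_of_le₀ ?_ (sq_nonneg _))
  exact hb1.trans (one_le_pow₀ (by linarith))

namespace WellSpread

theorem le_card_disc (h : WellSpread c n ω) (hR : 0 < localRadius c n) (z : Pt) {ρ : ℝ}
    (hρ : localRadius c n / 4 ≤ ρ) (hρL : ρ ≤ 2 * √n) :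
    ρ ^ 2 / 64 < ((nodeSet n ω).filter fun y => torusDist √n y z ≤ ρ).card := by
  have hn := pos_of_localRadius_pos hR
  have hL : 0 < √(n : ℝ) := Real.sqrt_pos.2 (Nat.cast_pos.2 hn)
  have hρ0 : 0 < ρ := by linarith
  set M : ℕ := ⌈2 * √n / ρ⌉₊
  have hM : 0 < M := Nat.ceil_pos.2 (by positivity)
  have hMgrid : M ≤ gridSize c n := by
    refine Nat.ceil_mono ?_
    rw [div_le_div_iff₀ hρ0 hR]
    nlinarith
  have hfine : 2 * (√n / M) ≤ ρ := by
    rw [← mul_div_assoc, div_le_comm₀ (Nat.cast_pos.2 hM) hρ0]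
    exact Nat.le_ceil _
  have hcoarse : M * ρ ≤ 4 * √n := by
    have hlt : (M : ℝ) < 2 * √n / ρ + 1 := Nat.ceil_lt_add_one (by positivity)
    have hmul := mul_le_mul_of_nonneg_right hlt.le hρ0.le
    rw [add_mul, div_mul_cancel₀ _ hρ0.ne'] at hmul
    linarith
  obtain ⟨i, hi, j, hj, hij⟩ := exists_cell_torusDist_le hL hM z
  have hsub : indexCount (cell M i j) ω ≤
      ((nodeSet n ω).filter fun y => torusDist √n y z ≤ ρ).card :=
    indexCount_le_card_filter_nodeSet hn h.injective fun u hu =>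
      (hij _ hu.1 _ hu.2).trans hfine
  calc ρ ^ 2 / 64 ≤ n / (4 * M ^ 2) := by
        have hsq := pow_le_pow_left₀ (by positivity) hcoarse 2
        rw [mul_pow, mul_pow, Real.sq_sqrt (Nat.cast_nonneg n)] at hsq
        rw [div_le_div_iff₀ (by norm_num) (by positivity)]
        linarith
    _ < (indexCount (cell M i j) ω : ℝ) := h.cell_lt M (Finset.mem_Icc.2 ⟨hM, hMgrid⟩) i hi j hj
    _ ≤ _ := Nat.cast_le.2 hsub

theorem hasCloserContacts (h : WellSpread c n ω) (hR : 0 < localRadius c n)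
    (hRn : localRadius c n ≤ √n) (t : Pt) : HasCloserContacts c n (nodeSet n ω) t := by
  intro x _ hxt
  obtain ⟨z, hxz, hzt⟩ := exists_torusDist_toward (h := localRadius c n / 2) (by linarith)
    ((half_le_self hR.le).trans hxt)
  have hcard := h.le_card_disc hR z le_rfl (by linarith)
  obtain ⟨y, hy⟩ := Finset.card_pos.1
    (Nat.cast_pos.1 (lt_of_le_of_lt (by positivity) hcard))
  obtain ⟨hyV, hyz⟩ := Finset.mem_filter.1 hy
  have hxy := torusDist_triangle √n x z y
  have hyt := torusDist_triangle √n y z t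
  rw [torusDist_comm √n z y] at hxy
  exact ⟨y, hyV, by linarith, by linarith⟩

theorem hasAnnulusShortcuts (h : WellSpread c n ω) (hR : 1 ≤ localRadius c n) {a b : ℝ}
    (hb : 0 ≤ b) (hb1 : b ≤ 1) (hba : b ≤ a) (t : Pt) :
    HasAnnulusShortcuts c n a (nodeSet n ω) t (b / 50000) := by
  intro x _ r hr hxr hxr'
  have hR0 : 0 < localRadius c n := by linarith
  have hL : 0 < √(n : ℝ) := Real.sqrt_pos.2 (Nat.cast_pos.2 (pos_of_localRadius_pos hR0))
  have hrL : 5 * r / 16 ≤ √n / 2 := by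
    nlinarith [torusDist_sq_le hL.ne' x t]
  -- The disc of radius `r / 17` around `z` lies inside the annulus.
  set z : Pt := (t.1 + 5 * r / 16, t.2)
  have hz : torusDist √n z t = 5 * r / 16 := torusDist_horizontal hL (by linarith) hrL t
  have hcard := h.le_card_disc hR0 z (ρ := r / 17) (by linarith) (by linarith)
  set D := (nodeSet n ω).filter fun y => torusDist √n y z ≤ r / 17
  have hDt : ∀ y ∈ D, r / 4 < torusDist √n y t ∧ torusDist √n y t < 3 * r / 8 := by
    intro y hy
    have hyz := (Finset.mem_filter.1 hy).2
    have hyt := torusDist_triangle √n y z t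
    have hzt := torusDist_triangle √n z y t
    rw [torusDist_comm √n z y] at hzt
    constructor <;> linarith
  have hprob : ∀ y ∈ D, b / (3 * r / 2) ^ 2 ≤ shortcutProb c n a x y := by
    intro y hy
    have hyt := (hDt y hy).2
    have hxy := torusDist_triangle √n x t y
    have hxt := torusDist_triangle √n x y t
    rw [torusDist_comm √n t y] at hxy
    exact le_shortcutProb hR hb hb1 hba (by linarith) (by linarith)
  have hr0 : 0 < r := by linarith
  calc b / 50000 ≤ b / 41616 := div_le_div_of_nonneg_left hb (by norm_num) (by norm_num)
    _ = ((r / 17) ^ 2 / 64) * (b / (3 * r / 2) ^ 2) := by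
        field_simp
        ring
    _ ≤ D.card * (b / (3 * r / 2) ^ 2) := by gcongr
    _ ≤ ∑ y ∈ D, shortcutProb c n a x y := by
        rw [← nsmul_eq_mul]
        exact Finset.card_nsmul_le_sum _ _ _ hprob
    _ ≤ _ := Finset.sum_le_sum_of_subset_of_nonneg
        (fun y hy => mem_annulusNodes.2
          ⟨(Finset.mem_filter.1 hy).1, (hDt y hy).1, (hDt y hy).2.le.trans (by linarith)⟩)
        fun y _ _ => (pairProb_mem_Icc (hb.trans hba) s(x, y)).1

theorem card_near_le (h : WellSpread c n ω) (hR : 0 < localRadius c n) (t : Pt) :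
    ((nodeSet n ω).filter fun y => torusDist √n y t ≤ 8 * localRadius c n).card ≤
      ⌈650 * localRadius c n ^ 2⌉₊ := by
  have hL : 0 < √(n : ℝ) := Real.sqrt_pos.2 (Nat.cast_pos.2 (pos_of_localRadius_pos hR))
  have hM : (0 : ℝ) < gridSize c n := Nat.cast_pos.2 (gridSize_pos hR)
  obtain ⟨i, hi, j, hj, hij⟩ := exists_cell_torusDist_le hL (gridSize_pos hR) t
  have corner (k : ℕ) : (k : ℝ) / gridSize c n ∈
      Set.Ico ((k : ℝ) / gridSize c n) ((k + 1) / gridSize c n) :=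
    Set.left_mem_Ico.2 (div_lt_div_of_pos_right (lt_add_one _) hM)
  have hgrid : torusDist √n t (gridPoint c n i j) ≤ localRadius c n := by
    rw [torusDist_comm]
    have hside := sqrt_div_gridSize_le hR
    exact (hij _ (corner i) _ (corner j)).trans (by linarith)
  have hdisc : ((nodeSet n ω).filter fun y => torusDist √n y t ≤ 8 * localRadius c n).card ≤
      indexCount (discRegion n (gridPoint c n i j) (9 * localRadius c n)) ω :=
    card_filter_nodeSet_le n ω fun u hu =>
      (torusDist_triangle √n _ t _).trans (by linarith)
  have hcount := (h.disc_lt i hi j hj).le.trans (Nat.le_ceil _)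
  exact hdisc.trans (by exact_mod_cast hcount)

theorem card_nodeSet_le (h : WellSpread c n ω) : ((nodeSet n ω).card : ℝ) ≤ 4 * n := by
  have : (nodeSet n ω).card ≤ ω.1 := Finset.card_image_le.trans_eq (Finset.card_range _)
  exact (Nat.cast_le.2 this).trans h.count_lt.le

end WellSpread

theorem exp_neg_four_mul_log (hn : 0 < n) : Real.exp (-(4 * Real.log n)) = ((n : ℝ) ^ 4)⁻¹ := by
  rw [← Real.exp_log (pow_pos (Nat.cast_pos.2 hn) 4), ← Real.exp_neg, Real.log_pow, Nat.cast_ofNat]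

theorem measure_biUnion_le_one_div {Ω ι : Type*} [MeasurableSpace Ω] (μ : Measure Ω)
    (hn : 0 < n) {s : Finset ι} (hs : s.card ≤ n ^ 3) {E : ι → Set Ω}
    (hE : ∀ m ∈ s, μ (E m) ≤ ENNReal.ofReal (Real.exp (-(4 * Real.log n)))) :
    μ (⋃ m ∈ s, E m) ≤ ENNReal.ofReal (1 / n) := by
  have : (0 : ℝ) < n := Nat.cast_pos.2 hn
  have hs' : (s.card : ℝ) ≤ n ^ 3 := by exact_mod_cast hs
  calc μ (⋃ m ∈ s, E m) ≤ s.card * ENNReal.ofReal (((n : ℝ) ^ 4)⁻¹) := by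
        rw [← nsmul_eq_mul, ← exp_neg_four_mul_log hn]
        exact (measure_biUnion_finset_le _ _).trans (Finset.sum_le_card_nsmul _ _ _ hE)
    _ = ENNReal.ofReal (s.card * ((n : ℝ) ^ 4)⁻¹) := by
        rw [ENNReal.ofReal_mul (Nat.cast_nonneg _), ENNReal.ofReal_natCast]
    _ ≤ ENNReal.ofReal (n ^ 3 * ((n : ℝ) ^ 4)⁻¹) := by gcongr
    _ = ENNReal.ofReal (1 / n) := by
        congr 1
        field_simp

theorem nodeLaw_indexCount_cell_le (hn : 3 ≤ n) (hc : 1296 ≤ c) (hRn : localRadius c n ≤ √n)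
    {M i j : ℕ} (hM : M ∈ Finset.Icc 1 (gridSize c n)) (hi : i < M) (hj : j < M) :
    nodeLaw n {ω | (indexCount (cell M i j) ω : ℝ) ≤ n / (4 * M ^ 2)} ≤
      ENNReal.ofReal (Real.exp (-(4 * Real.log n))) := by
  obtain ⟨hM1, hM⟩ := Finset.mem_Icc.1 hM
  have hR : 1 ≤ localRadius c n := one_le_localRadius (by linarith) hn
  have h := poissonSample_indexCount_le (n : ℝ≥0) volume (measurableSet_cell M i j)
  have hmean : (n : ℝ) * (1 / (M : ℝ) ^ 2) / 4 = n / (4 * M ^ 2) := by ring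
  rw [measureReal_cell hi hj, NNReal.coe_natCast, hmean] at h
  refine h.trans (ENNReal.ofReal_le_ofReal (Real.exp_le_exp.2 (neg_le_neg ?_)))
  have hMR : M * localRadius c n ≤ 9 * √n :=
    (mul_le_mul_of_nonneg_right (Nat.cast_le.2 hM) (by linarith)).trans
      (gridSize_mul_localRadius_le (by linarith) hRn)
  have hsq := pow_le_pow_left₀ (by positivity) hMR 2
  rw [mul_pow, mul_pow, Real.sq_sqrt (Nat.cast_nonneg n), localRadius_sq (by linarith)] at hsq
  have hlog : 1296 * (Real.log n * M ^ 2) ≤ c * (Real.log n * M ^ 2) :=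
    mul_le_mul_of_nonneg_right hc (mul_nonneg (Real.log_natCast_nonneg n) (sq_nonneg _))
  rw [le_div_iff₀ (by positivity)]
  linarith

theorem nodeLaw_cell_le (hn : 81 ≤ n) (hc : 1296 ≤ c) (hRn : localRadius c n ≤ √n) :
    nodeLaw n {ω | ∃ M ∈ Finset.Icc 1 (gridSize c n), ∃ i < M, ∃ j < M,
      (indexCount (cell M i j) ω : ℝ) ≤ n / (4 * M ^ 2)} ≤ ENNReal.ofReal (1 / n) := by
  have hR : 1 ≤ localRadius c n := one_le_localRadius (by linarith) (by omega)
  have hgrid : gridSize c n ≤ n := gridSize_le hn hR hRn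
  set I : Finset (Σ _ : ℕ, ℕ × ℕ) :=
    (Finset.Icc 1 (gridSize c n)).sigma fun M => Finset.range M ×ˢ Finset.range M with hI
  have mem_I (m : Σ _ : ℕ, ℕ × ℕ) : m ∈ I ↔
      m.1 ∈ Finset.Icc 1 (gridSize c n) ∧ m.2.1 < m.1 ∧ m.2.2 < m.1 := by
    simp only [hI, Finset.mem_sigma, Finset.mem_product, Finset.mem_range]
  have hIcard : I.card ≤ n ^ 3 :=
    calc I.card = ∑ M ∈ Finset.Icc 1 (gridSize c n), M * M := by
          simp only [hI, Finset.card_sigma, Finset.card_product, Finset.card_range]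
      _ ≤ ∑ _M ∈ Finset.Icc 1 (gridSize c n), n * n :=
          Finset.sum_le_sum fun M hM =>
            have hMn := (Finset.mem_Icc.1 hM).2.trans hgrid
            Nat.mul_le_mul hMn hMn
      _ = gridSize c n * (n * n) := by simp
      _ ≤ n * (n * n) := Nat.mul_le_mul_right _ hgrid
      _ = n ^ 3 := by ring
  set E : (Σ _ : ℕ, ℕ × ℕ) → Set NodeSpace := fun m =>
    {ω | (indexCount (cell m.1 m.2.1 m.2.2) ω : ℝ) ≤ n / (4 * (m.1 : ℝ) ^ 2)}
  have hE (m) (hm : m ∈ I) : nodeLaw n (E m) ≤ ENNReal.ofReal (Real.exp (-(4 * Real.log n))) :=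
    have ⟨hM, hi, hj⟩ := (mem_I m).1 hm
    nodeLaw_indexCount_cell_le (by omega) hc hRn hM hi hj
  refine (measure_mono fun ω hω => ?_).trans
    (measure_biUnion_le_one_div (nodeLaw n) (by omega) hIcard hE)
  obtain ⟨M, hM, i, hi, j, hj, hω⟩ := hω
  exact Set.mem_iUnion₂.2 ⟨⟨M, i, j⟩, (mem_I _).2 ⟨hM, hi, hj⟩, hω⟩

theorem nodeLaw_disc_le (hn : 81 ≤ n) (hc : 1296 ≤ c) (hRn : localRadius c n ≤ √n) :
    nodeLaw n {ω | ∃ i < gridSize c n, ∃ j < gridSize c n, 650 * localRadius c n ^ 2 ≤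
      (indexCount (discRegion n (gridPoint c n i j) (9 * localRadius c n)) ω : ℝ)} ≤
      ENNReal.ofReal (1 / n) := by
  have hR : 1 ≤ localRadius c n := one_le_localRadius (by linarith) (by omega)
  have hcard : (Finset.range (gridSize c n) ×ˢ Finset.range (gridSize c n)).card ≤ n ^ 3 := by
    rw [Finset.card_product, Finset.card_range, ← sq]
    calc gridSize c n ^ 2 ≤ n ^ 2 := Nat.pow_le_pow_left (gridSize_le hn hR hRn) 2
      _ ≤ n ^ 3 := Nat.pow_le_pow_right (by omega) (by norm_num)
  refine (measure_mono ?_).trans (measure_biUnion_le_one_div (nodeLaw n) (by omega) hcard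
    (E := fun m => {ω | 650 * localRadius c n ^ 2 ≤
      (indexCount (discRegion n (gridPoint c n m.1 m.2) (9 * localRadius c n)) ω : ℝ)}) ?_)
  · rintro ω ⟨i, hi, j, hj, hω⟩
    exact Set.mem_biUnion (x := (i, j))
      (Finset.mk_mem_product (Finset.mem_range.2 hi) (Finset.mem_range.2 hj)) hω
  · rintro ⟨i, j⟩ -
    have h := poissonSample_le_indexCount (n : ℝ≥0) volume
      (measurableSet_discRegion n (gridPoint c n i j) (9 * localRadius c n))
      (650 * localRadius c n ^ 2)
    refine h.trans (ENNReal.ofReal_le_ofReal (Real.exp_le_exp.2 ?_))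
    have hvol := measureReal_discRegion_le (n := n) (by omega) (gridPoint c n i j)
      (ρ := 9 * localRadius c n) (by positivity)
    have hmean : (n : ℝ) * volume.real (discRegion n (gridPoint c n i j) (9 * localRadius c n)) ≤
        324 * localRadius c n ^ 2 := by
      rw [le_div_iff₀' (Nat.cast_pos.2 (by omega))] at hvol
      linarith
    have hlog : 1296 * Real.log n ≤ localRadius c n ^ 2 := by
      rw [localRadius_sq (by linarith)]
      exact mul_le_mul_of_nonneg_right hc (Real.log_natCast_nonneg n)
    rw [NNReal.coe_natCast]
    linarith [Real.log_natCast_nonneg n]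

theorem nodeLaw_count_le (hn : 0 < n) :
    nodeLaw n {ω | 4 * (n : ℝ) ≤ ω.1} ≤ ENNReal.ofReal (1 / n) := by
  have hn' : (0 : ℝ) < n := Nat.cast_pos.2 hn
  have h := poissonSample_le_indexCount (n : ℝ≥0)
    (volume : Measure (unitInterval × unitInterval)) MeasurableSet.univ (4 * n)
  simp only [indexCount, Set.mem_univ, Finset.filter_true, Finset.card_range, probReal_univ,
    NNReal.coe_natCast] at h
  refine h.trans (ENNReal.ofReal_le_ofReal ?_)
  rw [one_div, ← Real.exp_log (inv_pos.2 hn'), Real.log_inv, Real.exp_le_exp]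
  linarith [Real.log_le_self hn'.le]

theorem nodeLaw_not_wellSpread_le (hn : 81 ≤ n) (hc : 1296 ≤ c) (hRn : localRadius c n ≤ √n) :
    nodeLaw n {ω | ¬ WellSpread c n ω} ≤ ENNReal.ofReal (3 / n) := by
  have hinj : nodeLaw n {ω : NodeSpace | ¬ Function.Injective ω.2} = 0 := by
    rw [nodeLaw_eq_poissonSample, Measure.volume_eq_prod]
    exact ae_injective_poissonSample _ _
  refine (measure_mono (fun ω hω => ?_)).trans <| (measure_union_le _ _).trans <|
    (add_le_add hinj.le <| (measure_union_le _ _).trans <|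
      add_le_add (nodeLaw_cell_le hn hc hRn) <| (measure_union_le _ _).trans <|
        add_le_add (nodeLaw_disc_le hn hc hRn) (nodeLaw_count_le (by omega))).trans_eq ?_
  · by_contra hgood
    simp only [Set.mem_union, Set.mem_ofPred_eq, not_or, not_exists, not_and, not_le, not_not]
      at hgood
    obtain ⟨hinj, hcell, hdisc, hcount⟩ := hgood
    exact hω ⟨hinj, hcell, hdisc, hcount⟩
  · rw [zero_add, ← ENNReal.ofReal_add (by positivity) (by positivity),
      ← ENNReal.ofReal_add (by positivity) (by positivity)]
    congr 1
    ring

end Density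

/-! ### The normalization -/

section Normalization

variable {c : ℝ} {n : ℕ}

theorem sqrt_natCast_lt_two_pow_ceil_log (hn : 1 < n) : √(n : ℝ) < 2 ^ ⌈Real.log n⌉₊ := by
  have hn' : (0 : ℝ) < n := Nat.cast_pos.2 (by omega)
  have hlog : 0 < Real.log n := Real.log_pos (Nat.one_lt_cast.2 hn)
  calc √(n : ℝ) = Real.exp (Real.log n / 2) := by rw [Real.exp_half, Real.exp_log hn']
    _ < Real.exp (Real.log n * Real.log 2) :=
        Real.exp_lt_exp.2 (by nlinarith [Real.log_two_gt_d9])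
    _ ≤ Real.exp (⌈Real.log n⌉₊ * Real.log 2) := by
        gcongr
        exact Nat.le_ceil _
    _ = 2 ^ ⌈Real.log n⌉₊ := by rw [Real.exp_nat_mul, Real.exp_log two_pos]

theorem shortcutProb_le_sum_indicator (hR : 0 < localRadius c n) {J : ℕ}
    (hJ : √n < 2 ^ J * localRadius c n) (a : ℝ) (x : Pt) (u : unitInterval × unitInterval) :
    ENNReal.ofReal (shortcutProb c n a x (location n u)) ≤
      ∑ j ∈ Finset.range J, (discRegion n x (2 * (2 ^ j * localRadius c n))).indicator
        (fun _ => ENNReal.ofReal (a / (2 ^ j * localRadius c n) ^ 2)) u := by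
  have hL : 0 < √(n : ℝ) := Real.sqrt_pos.2 (Nat.cast_pos.2 (pos_of_localRadius_pos hR))
  rw [shortcutProb]
  split_ifs with h
  swap
  · simp
  obtain ⟨j, hle, hlt⟩ := exists_nat_pow_near ((one_le_div hR).2 h.le) one_lt_two
  rw [le_div_iff₀ hR] at hle
  rw [div_lt_iff₀ hR, pow_succ', mul_assoc] at hlt
  have hjJ : j < J := by
    have hpow : (2 : ℝ) ^ j * localRadius c n < 2 ^ J * localRadius c n :=
      hle.trans_lt ((torusDist_le_period hL _ _).trans_lt hJ)
    exact (pow_lt_pow_iff_right₀ one_lt_two).1 (lt_of_mul_lt_mul_right hpow hR.le)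
  have hmem : u ∈ discRegion n x (2 * (2 ^ j * localRadius c n)) := by
    change torusDist √n (location n u) x ≤ _
    rw [torusDist_comm]
    exact hlt.le
  refine le_trans ?_ (Finset.single_le_sum (fun _ _ => zero_le) (Finset.mem_range.2 hjJ))
  rw [Set.indicator_of_mem hmem]
  calc ENNReal.ofReal (min (a / torusDist √n x (location n u) ^ 2) 1)
      ≤ ENNReal.ofReal (a * (torusDist √n x (location n u) ^ 2)⁻¹) :=
        ENNReal.ofReal_le_ofReal (min_le_left _ _)
    _ = ENNReal.ofReal a * ENNReal.ofReal (torusDist √n x (location n u) ^ 2)⁻¹ :=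
        ENNReal.ofReal_mul' (by positivity)
    _ ≤ ENNReal.ofReal a * ENNReal.ofReal ((2 ^ j * localRadius c n) ^ 2)⁻¹ := by gcongr
    _ = ENNReal.ofReal (a / (2 ^ j * localRadius c n) ^ 2) :=
        (ENNReal.ofReal_mul' (by positivity)).symm

theorem mul_lintegral_indicator_discRegion_le (hn : 0 < n) (a : ℝ) (x : Pt) {ρ : ℝ} (hρ : 0 < ρ) :
    n * ∫⁻ u, (discRegion n x (2 * ρ)).indicator (fun _ => ENNReal.ofReal (a / ρ ^ 2)) u ≤
      ENNReal.ofReal (16 * a) := by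
  have hn' : (0 : ℝ) < n := Nat.cast_pos.2 hn
  calc n * ∫⁻ u, (discRegion n x (2 * ρ)).indicator (fun _ => ENNReal.ofReal (a / ρ ^ 2)) u
      = ENNReal.ofReal n *
          (ENNReal.ofReal (a / ρ ^ 2) * ENNReal.ofReal (volume.real (discRegion n x (2 * ρ)))) := by
        rw [lintegral_indicator_const (measurableSet_discRegion _ _ _), ofReal_measureReal,
          ENNReal.ofReal_natCast]
    _ ≤ ENNReal.ofReal n *
          (ENNReal.ofReal (a / ρ ^ 2) * ENNReal.ofReal (4 * (2 * ρ) ^ 2 / n)) := by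
        gcongr
        exact measureReal_discRegion_le hn x (by positivity)
    _ = ENNReal.ofReal (16 * a) := by
        rw [← ENNReal.ofReal_mul' (by positivity), ← ENNReal.ofReal_mul hn'.le]
        congr 1
        field_simp
        ring

theorem expectedShortcuts_le (hn : 3 ≤ n) (hR : 1 ≤ localRadius c n) (a : ℝ) (x : Pt) :
    expectedShortcuts c n a x ≤ ENNReal.ofReal (32 * a * Real.log n) := by
  have hR0 : 0 < localRadius c n := by linarith
  have hlog := one_le_log_natCast hn
  set J := ⌈Real.log n⌉₊
  have hJ : (J : ℝ) ≤ 2 * Real.log n := by linarith [Nat.ceil_lt_add_one (zero_le_one.trans hlog)]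
  have hcover : √n < 2 ^ J * localRadius c n :=
    (sqrt_natCast_lt_two_pow_ceil_log (by omega)).trans_le
      (le_mul_of_one_le_right (by positivity) hR)
  set shell : ℕ → unitInterval × unitInterval → ℝ≥0∞ := fun j =>
    (discRegion n x (2 * (2 ^ j * localRadius c n))).indicator
      fun _ => ENNReal.ofReal (a / (2 ^ j * localRadius c n) ^ 2)
  have hmeas (j : ℕ) : Measurable (shell j) :=
    measurable_const.indicator (measurableSet_discRegion _ _ _)
  have hshell (j : ℕ) : n * ∫⁻ u, shell j u ≤ ENNReal.ofReal (16 * a) :=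
    mul_lintegral_indicator_discRegion_le (by omega) a x (by positivity)
  calc expectedShortcuts c n a x
      ≤ ∫⁻ ω, ∑ i ∈ Finset.range ω.1, ∑ j ∈ Finset.range J, shell j (ω.2 i) ∂nodeLaw n := by
        refine lintegral_mono fun ω => ?_
        rw [nodeSet_eq_image_location]
        exact (Finset.sum_image_le_of_nonneg (fun _ _ => zero_le)).trans
          (Finset.sum_le_sum fun i _ => shortcutProb_le_sum_indicator hR0 hcover a x _)
    _ = n * ∑ j ∈ Finset.range J, ∫⁻ u, shell j u := by
        rw [nodeLaw_eq_poissonSample, lintegral_sum_poissonSample _ _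
          (Finset.measurable_fun_sum _ fun j _ => hmeas j),
          lintegral_finsetSum _ fun j _ => hmeas j, ENNReal.coe_natCast]
    _ ≤ J * ENNReal.ofReal (16 * a) := by
        rw [Finset.mul_sum]
        refine (Finset.sum_le_card_nsmul _ _ _ fun j _ => hshell j).trans_eq ?_
        rw [Finset.card_range, nsmul_eq_mul]
    _ ≤ ENNReal.ofReal (2 * Real.log n) * ENNReal.ofReal (16 * a) := by
        rw [← ENNReal.ofReal_natCast]
        gcongr
    _ = ENNReal.ofReal (32 * a * Real.log n) := by
        rw [← ENNReal.ofReal_mul (by positivity)]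
        congr 1
        ring

theorem div_log_le_of_le_expectedShortcuts (hn : 3 ≤ n) (hR : 1 ≤ localRadius c n) {a δ : ℝ}
    (hδ : 0 < δ) {x : Pt} (h : ENNReal.ofReal δ ≤ expectedShortcuts c n a x) :
    δ / (32 * Real.log n) ≤ a := by
  have hlog := one_le_log_natCast hn
  have hle := h.trans (expectedShortcuts_le hn hR a x)
  rw [ENNReal.ofReal_le_ofReal_iff'] at hle
  rw [div_le_iff₀ (by positivity)]
  linarith [hle.resolve_right hδ.not_ge]

end Normalization

/-! ### The limit -/

section Limit

variable {c : ℝ} {n : ℕ} {a δ : ℝ}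

instance isProbabilityMeasure_nodeLaw (n : ℕ) : IsProbabilityMeasure (nodeLaw n) :=
  isProbabilityMeasure_poissonSample n volume

theorem graphProb_le_one (ha : 0 ≤ a) (E : Finset Pt → Finset (Sym2 Pt) → Prop) :
    graphProb c n a E ≤ 1 := by
  classical
  exact (lintegral_mono fun _ => ENNReal.ofReal_le_one.2
    (sum_shortcutWeight_le_one ha _ _)).trans_eq (by rw [lintegral_one, measure_univ])

theorem le_lintegral_add_mul {Ω : Type*} [MeasurableSpace Ω] (μ : Measure Ω)
    [IsProbabilityMeasure μ] {f : Ω → ℝ≥0∞} {B : Set Ω} {b : ℝ≥0∞} (hf : ∀ ω ∉ B, b ≤ f ω) :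
    b ≤ ∫⁻ ω, f ω ∂μ + b * μ B := by
  -- `f` and `B` need not be measurable, so the integral is split along the measurable hull of `B`.
  have hT : MeasurableSet (toMeasurable μ B) := measurableSet_toMeasurable μ B
  calc b = b * μ (toMeasurable μ B)ᶜ + b * μ (toMeasurable μ B) := by
        rw [← mul_add, add_comm, measure_add_measure_compl hT, measure_univ, mul_one]
    _ = ∫⁻ _ in (toMeasurable μ B)ᶜ, b ∂μ + b * μ B := by
        rw [setLIntegral_const, measure_toMeasurable]
    _ ≤ ∫⁻ ω in (toMeasurable μ B)ᶜ, f ω ∂μ + b * μ B := by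
        gcongr ?_ + _
        exact setLIntegral_mono' hT.compl fun ω hω => hf ω fun h => hω (subset_toMeasurable μ B h)
    _ ≤ ∫⁻ ω, f ω ∂μ + b * μ B := by
        gcongr ?_ + _
        exact setLIntegral_le_lintegral _ _

theorem one_add_exp_neg_div_two_pow_le {q : ℝ} (hq0 : 0 ≤ q) (hq1 : q ≤ 1) (k : ℕ) :
    ((1 + Real.exp (-q)) / 2) ^ k ≤ Real.exp (-(q * k / 4)) := by
  have hexp : Real.exp (-q) ≤ 1 - q / 2 := by
    calc Real.exp (-q) ≤ (1 + q)⁻¹ := by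
          rw [Real.exp_neg]
          exact inv_anti₀ (by linarith) (by linarith [Real.add_one_le_exp q])
      _ ≤ 1 - q / 2 := by
          rw [inv_le_iff_one_le_mul₀ (by linarith)]
          nlinarith
  have hbase : (1 + Real.exp (-q)) / 2 ≤ Real.exp (-(q / 4)) := by
    linarith [Real.add_one_le_exp (-(q / 4))]
  calc _ ≤ Real.exp (-(q / 4)) ^ k := pow_le_pow_left₀ (by positivity) hbase k
    _ = _ := by
        rw [← Real.exp_nat_mul]
        congr 1
        ring

theorem contraction_pow_le (hn : 3 ≤ n) (hδ : 0 < δ) (hδ1 : δ ≤ 1) {k : ℕ}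
    (hk : 25600000 / δ * Real.log n ^ 2 ≤ k) :
    ((1 + Real.exp (-(δ / (32 * Real.log n) / 50000))) / 2) ^ k ≤ ((n : ℝ) ^ 4)⁻¹ := by
  have hlog := one_le_log_natCast hn
  have hq1 : δ / (32 * Real.log n) / 50000 ≤ 1 := by
    rw [div_div, div_le_one (by positivity)]
    linarith
  refine (one_add_exp_neg_div_two_pow_le (by positivity) hq1 k).trans ?_
  rw [← exp_neg_four_mul_log (by omega), Real.exp_le_exp, neg_le_neg_iff]
  calc 4 * Real.log n
      = δ / (32 * Real.log n) / 50000 * (25600000 / δ * Real.log n ^ 2) / 4 := by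
        field_simp
        norm_num
    _ ≤ δ / (32 * Real.log n) / 50000 * k / 4 := by gcongr

/-- A constant `C` for which `C log² n` hops suffice when the expected number of shortcuts is at
least `δ ≤ 1`: the first term pays for the hops at large radius, the second one for the hops at
radius at most `8 √(c log n)`, and the third one for rounding. -/
noncomputable def hopConstant (c δ : ℝ) : ℝ := 25600000 / δ + 3250 * c + 11

theorem hops_le_hopConstant (hn : 3 ≤ n) (hc : 0 ≤ c) (hδ : 0 < δ) :
    ((5 * ⌈650 * localRadius c n ^ 2⌉₊ + 5 + ⌈25600000 / δ * Real.log n ^ 2⌉₊ : ℕ) : ℝ) ≤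
      hopConstant c δ * Real.log n ^ 2 := by
  have hlog := one_le_log_natCast hn
  have hN := Nat.ceil_lt_add_one (a := 650 * localRadius c n ^ 2) (by positivity)
  have hk := Nat.ceil_lt_add_one (a := 25600000 / δ * Real.log n ^ 2) (by positivity)
  rw [localRadius_sq hc] at hN
  have hlog_sq : Real.log n ≤ Real.log n ^ 2 := le_self_pow₀ hlog two_ne_zero
  have hc_sq : c * Real.log n ≤ c * Real.log n ^ 2 := mul_le_mul_of_nonneg_left hlog_sq hc
  rw [localRadius_sq hc, hopConstant]
  push_cast
  linarith

theorem WellSpread.one_sub_le_sum_shortcutWeight {ω : NodeSpace} (h : WellSpread c n ω)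
    {next : View → Pt} (hnext : IsApproxGreedy n next) (hn : 3 ≤ n) (hc : 1 ≤ c)
    (hRn : localRadius c n ≤ √n) (hδ : 0 < δ) (hδ1 : δ ≤ 1) (hδa : δ / (32 * Real.log n) ≤ a)
    [DecidablePred (AllDeliveredWithin c n next (hopConstant c δ * Real.log n ^ 2)
      (nodeSet n ω))] :
    1 - 16 / (n : ℝ) ≤ ∑ S ∈ (nodePairs (nodeSet n ω)).powerset.filter
        (AllDeliveredWithin c n next (hopConstant c δ * Real.log n ^ 2) (nodeSet n ω)),
      shortcutWeight c n a (nodeSet n ω) S := by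
  have hlog := one_le_log_natCast hn
  have hn1 : (1 : ℝ) ≤ n := Nat.one_le_cast.2 (by omega)
  have hR : 1 ≤ localRadius c n := one_le_localRadius hc hn
  have hR0 : 0 < localRadius c n := by linarith
  have hb1 : δ / (32 * Real.log n) ≤ 1 := by
    rw [div_le_one (by positivity)]
    linarith
  refine le_trans ?_ <| le_sum_shortcutWeight_allDeliveredWithin hnext hR0
    ((by positivity : 0 ≤ δ / (32 * Real.log n)).trans hδa)
    (fun t _ => h.hasCloserContacts hR0 hRn t) (fun t _ => h.card_near_le hR0 t)
    (fun t _ => h.hasAnnulusShortcuts hR (by positivity) hb1 hδa t)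
    (hops_le_hopConstant hn (by linarith) hδ)
  have hcard := h.card_nodeSet_le
  have hpow := contraction_pow_le hn hδ hδ1 (Nat.le_ceil _)
  have hstart : √n / localRadius c n ≤ n := (div_le_self (Real.sqrt_nonneg _) hR).trans
    (Real.sqrt_le_iff.2 ⟨by linarith, le_self_pow₀ hn1 two_ne_zero⟩)
  rw [sub_le_sub_iff_left]
  calc _ ≤ (4 * (n : ℝ)) ^ 2 * (n * ((n : ℝ) ^ 4)⁻¹) := by gcongr
    _ = 16 / n := by
        field_simp
        norm_num

theorem le_graphProb_allDeliveredWithin {next : View → Pt} (hnext : IsApproxGreedy n next)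
    (hn : 81 ≤ n) (hc : 1296 ≤ c) (hRn : localRadius c n ≤ √n) (hδ : 0 < δ) (hδ1 : δ ≤ 1)
    (hδa : δ / (32 * Real.log n) ≤ a) :
    ENNReal.ofReal (1 - 19 / n) ≤
      graphProb c n a (AllDeliveredWithin c n next (hopConstant c δ * Real.log n ^ 2)) := by
  classical
  have hlow : ENNReal.ofReal (1 - 16 / n) ≤
      graphProb c n a (AllDeliveredWithin c n next (hopConstant c δ * Real.log n ^ 2)) +
        ENNReal.ofReal (1 - 16 / n) * nodeLaw n {ω | ¬ WellSpread c n ω} :=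
    le_lintegral_add_mul (nodeLaw n) fun ω hω =>
      ENNReal.ofReal_le_ofReal <| (not_not.1 hω).one_sub_le_sum_shortcutWeight
        hnext (by omega) (by linarith) hRn hδ hδ1 hδa
  have hbad : ENNReal.ofReal (1 - 16 / n) * nodeLaw n {ω | ¬ WellSpread c n ω} ≤
      ENNReal.ofReal (3 / n) :=
    (mul_le_of_le_one_left zero_le (ENNReal.ofReal_le_one.2
      (sub_le_self _ (by positivity)))).trans (nodeLaw_not_wellSpread_le hn hc hRn)
  have hsplit : 1 - 19 / (n : ℝ) = 1 - 16 / n - 3 / n := by ring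
  rw [hsplit, ENNReal.ofReal_sub _ (by positivity), tsub_le_iff_right]
  exact hlow.trans (add_le_add_right hbad _)

theorem eventually_localRadius_le (c : ℝ) : ∀ᶠ n : ℕ in atTop, localRadius c n ≤ √n := by
  have hlittle := (Real.isLittleO_log_id_atTop.const_mul_left c).comp_tendsto
    tendsto_natCast_atTop_atTop
  filter_upwards [hlittle.bound one_pos] with n hn
  refine Real.sqrt_le_sqrt ((le_abs_self _).trans ?_)
  simpa only [Function.comp_apply, id_eq, Real.norm_eq_abs, Nat.abs_cast, one_mul] using hn

end Limit

end SmallWorld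

theorem mainTheorem1_general :
    ∃ c₀ : ℝ, 0 < c₀ ∧ ∀ c : ℝ, c₀ ≤ c → ∀ δ : ℝ, 0 < δ → ∃ C : ℝ, 0 < C ∧
      ∀ a : ℕ → ℝ,
        (∀ᶠ n : ℕ in atTop, ∃ x,
          ENNReal.ofReal δ ≤ SmallWorld.expectedShortcuts c n (a n) x) →
      ∀ next : ℕ → SmallWorld.View → SmallWorld.Pt,
        (∀ n, SmallWorld.IsApproxGreedy n (next n)) →
        Tendsto (fun n : ℕ => SmallWorld.graphProb c n (a n) fun V S =>
            ∀ s ∈ V, ∀ t ∈ V,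
              SmallWorld.DeliveredWithin c n (next n) V S s t (C * Real.log n ^ 2))
          atTop (𝓝 1) := by
  refine ⟨1296, by norm_num, fun c hc δ hδ => ⟨SmallWorld.hopConstant c (min δ 1), ?_, ?_⟩⟩
  · have : 0 < min δ 1 := lt_min hδ one_pos
    unfold SmallWorld.hopConstant
    positivity
  intro a ha next hnext
  have hlow : Tendsto (fun n : ℕ => ENNReal.ofReal (1 - 19 / (n : ℝ))) atTop (𝓝 1) := by
    simpa only [sub_zero, ENNReal.ofReal_one] using ENNReal.tendsto_ofReal
      ((tendsto_const_div_atTop_nhds_zero_nat (19 : ℝ)).const_sub 1)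
  have ha' : ∀ᶠ n : ℕ in atTop, min δ 1 / (32 * Real.log n) ≤ a n := by
    filter_upwards [ha, eventually_ge_atTop 3] with n ⟨x, hx⟩ hn
    exact SmallWorld.div_log_le_of_le_expectedShortcuts hn
      (SmallWorld.one_le_localRadius (by linarith) hn) (lt_min hδ one_pos)
      ((ENNReal.ofReal_le_ofReal (min_le_left _ _)).trans hx)
  refine tendsto_of_tendsto_of_tendsto_of_le_of_le' hlow tendsto_const_nhds ?_ ?_
  · filter_upwards [ha', eventually_ge_atTop 81, SmallWorld.eventually_localRadius_le c]
      with n han hn hRn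
    exact SmallWorld.le_graphProb_allDeliveredWithin (hnext n) hn hc hRn (lt_min hδ one_pos)
      (min_le_right _ _) han
  · filter_upwards [ha'] with n han
    refine SmallWorld.graphProb_le_one (le_trans ?_ han) _
    exact div_nonneg (lt_min hδ one_pos).le
      (mul_nonneg (by norm_num) (Real.log_natCast_nonneg n))

theorem mainTheorem1 :
    ∃ c₀ : ℝ, 0 < c₀ ∧ ∀ c : ℝ, c₀ ≤ c → ∃ C : ℝ, 0 < C ∧
      ∀ a : ℕ → ℝ,
        (∀ᶠ n : ℕ in atTop, ∀ x ∈ Set.Icc (0 : ℝ) √n ×ˢ Set.Icc (0 : ℝ) √n,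
          SmallWorld.expectedShortcuts c n (a n) x = 1) →
      ∀ next : ℕ → SmallWorld.View → SmallWorld.Pt,
        (∀ n, SmallWorld.IsApproxGreedy n (next n)) →
        Tendsto (fun n : ℕ => SmallWorld.graphProb c n (a n) fun V S =>
            ∀ s ∈ V, ∀ t ∈ V,
              SmallWorld.DeliveredWithin c n (next n) V S s t (C * Real.log n ^ 2))
          atTop (𝓝 1) := by
  obtain ⟨c₀, hc₀, h⟩ := mainTheorem1_general
  refine ⟨c₀, hc₀, fun c hc => (h c hc 1 one_pos).imp fun C hC => ⟨hC.1, fun a ha => hC.2 a ?_⟩⟩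
  filter_upwards [ha] with n hn
  refine ⟨(0, 0), ?_⟩
  rw [hn (0, 0) ⟨⟨le_rfl, Real.sqrt_nonneg _⟩, le_rfl, Real.sqrt_nonneg _⟩, ENNReal.ofReal_one]
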